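/- **Model.** There are $N\ge 1$ agents; agent $n$ has actions $\{1,\dots,|\mathcal A_n|\}$, finitely many observations $\mathcal O_n$, and a finite state controller with nodes $\{1,\dots,|\mathcal Z_n|\}$ (a fixed truncation level) that starts in node $1$. Its parameters are $\Theta_n=(W_n,\pi_n)$, where $W^{i,j}_{n,a,o}$ is the probability of moving from node $i$ to node $j$ after action $a$ and observation $o$, and $\pi^a_{n,i}$ is the probability of action $a$ in node $i$. So $$p(a_{n,0:t},z_{n,0:t}\mid o_{n,1:t},\Theta_n)=\mathbb I(z_{n,0}=1)\prod_{\tau=0}^t\pi^{a_{n,\tau}}_{n,z_{n,\tau}}\prod_{\tau=1}^tW^{z_{n,\tau-1},z_{n,\tau}}_{n,a_{n,\tau-1},o_{n,\tau}},$$ $p(a_{n,0:t}\mid o_{n,1:t},\Theta_n)$ is its sum over $z_{n,0:t}$, and $p(z_{n,0:t}\mid a_{n,0:t},o_{n,1:t},\Theta_n)$ is the quotient of the two. For positive hyper-parameters $h=(\sigma,\eta,\rho)$ let $p_h(\Theta)$ be the law under which all rows are independent, $\pi_{n,i}\sim\mathrm{Dir}(\rho_{n,i}^{1},\dots,\rho_{n,i}^{|\mathcal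 A_n|})$, and $W^{i,:}_{n,a,o}$ has the generalized Dirichlet (truncated stick-breaking) law $W^{i,j}=V^{i,j}\prod_{m<j}(1-V^{i,m})$ with independent $V^{i,j}_{n,a,o}\sim\mathrm{Beta}(\sigma^{i,j}_{n,a,o},\eta^{i,j}_{n,a,o})$ for $j<|\mathcal Z_n|$ and $V^{i,|\mathcal Z_n|}=1$. The prior is $p=p_{h_0}$, $h_0=(\sigma,\eta,\rho)$. **Data.** There are $K$ episodes, episode $k$ with steps $0,\dots,T_k$, actions $a^k_{n,t}$, observations $o^k_{n,t}$ and rewards $r^k_t\ge R_{\min}$; a discount $\gamma\in[0,1)$; and strictly positive behavior policies $p^{\Psi_n}(a\mid h)$. Put $\tilde r_t^k=\gamma^t(r_t^k-R_{\min})/\prod_n\prod_{\tau\le t}p^{\Psi_n}(a^k_{n,\tau}\mid h^k_{n,\tau})$, where $h^k_{n,\tau}$ is the local history of actions and observations, and assume that $\tilde r^k_t>0$ for some $k$ and $t\le T_k$. The empirical value is $\hat V(\mathcal D;\Theta)=\frac1K\sum_{k,t}\tilde r_t^k\prod_np(a^k_{n,0:t}\mid o^k_{n,1:t},\Theta_n)$,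 and the marginal empirical value is $\hat V(\mathcal D)=\int\hat V(\mathcal D;\Theta)\,p(\Theta)\,d\Theta$. **Variational problem.** Maximize $$\mathrm{LB}(q,q(\Theta))=\sum_{k,t,z_{1:N,0:t}}\int\frac{q_t^k(\vec z_{0:t})\,q(\Theta)}{K}\ln\frac{\tilde r_t^k\,p(\Theta)\prod_np(a^k_{n,0:t},z_{n,0:t}\mid o^k_{n,1:t},\Theta_n)}{q_t^k(\vec z_{0:t})\,q(\Theta)}\,d\Theta\in[-\infty,\infty)$$ over the mean-field feasible pairs: $q_t^k\ge0$ is a product over the agents, $\sum_{k,t,\vec z}q_t^k(\vec z_{0:t})=K$, and $q(\Theta)=\prod_nq(\Theta_n)$ is a probability law. A feasible pair is called a *maximum* if it maximizes $\mathrm{LB}$ with respect to each of its two factors, that is, over all feasible $\{q_t^k\}$ for its $q(\Theta)$ and over all feasible $q(\Theta)$ for its $\{q_t^k\}$. **Updates.** Given positive $\hat h=(\hat\sigma,\hat\eta,\hat\rho)$, let $\widetilde\Theta$ consist of $\widetilde\pi^a_{n,i}=\exp\langle\ln\pi^a_{n,i}\rangle_{p_{\hat h}}$ and $\widetilde W^{i,j}_{n,a,o}=\exp\langle\ln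 W^{i,j}_{n,a,o}\rangle_{p_{\hat h}}$, let $\hat\nu_t^k=\tilde r_t^k\prod_np(a^k_{n,0:t}\mid o^k_{n,1:t},\widetilde\Theta_n)/\hat V(\mathcal D;\widetilde\Theta)$, and set $$q_t^k(\vec z_{0:t})=\hat\nu_t^k\prod_np(z_{n,0:t}\mid a^k_{n,0:t},o^k_{n,1:t},\widetilde\Theta_n),$$ so that the marginal for agent $n$ is $q_t^k(z_{n,0:t})=\hat\nu_t^k\,p(z_{n,0:t}\mid a^k_{n,0:t},o^k_{n,1:t},\widetilde\Theta_n)$. Let $\xi^{n,k}_{t,\tau}(i,j)$ and $\phi^{n,k}_{t,\tau}(i)$ be the probabilities of $(z_{n,\tau},z_{n,\tau+1})=(i,j)$ and of $z_{n,\tau}=i$ under $p(\cdot\mid a^k_{n,0:t},o^k_{n,1:t},\widetilde\Theta_n)$. Then replace $\hat h$ by $$\hat\sigma^{i,j}_{n,a,o}=\sigma^{i,j}_{n,a,o}+\zeta^{i,j}_{n,a,o},\qquad\hat\eta^{i,j}_{n,a,o}=\eta^{i,j}_{n,a,o}+\sum_{l>j}\zeta^{i,l}_{n,a,o},\qquad\hat\rho^a_{n,i}=\rho^a_{n,i}+\sum_{k}\sum_{t=0}^{T_k}\sum_{\tau=0}^t\frac{\hat\nu^k_t}K\phi^{n,k}_{t,\tau}(i)\,\mathbb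 I(a^k_{n,\tau}=a),$$ $$\zeta^{i,j}_{n,a,o}=\sum_k\sum_{t=0}^{T_k}\sum_{\tau=1}^t\frac{\hat\nu_t^k}K\xi^{n,k}_{t,\tau-1}(i,j)\,\mathbb I(a^k_{n,\tau-1}=a,\ o^k_{n,\tau}=o).$$ **Theorem 1.** Start from any positive hyper-parameters and iterate the two updates. Then: * All iterates $(\{q_t^k\},p_{\hat h})$ are feasible with finite $\mathrm{LB}$. Moreover $\hat V(\mathcal D)>0$, and $\mathrm{LB}\le\ln\hat V(\mathcal D)$ at every feasible pair. * Neither of the two updates decreases $\mathrm{LB}$, and an iteration increases it strictly unless the current iterate is already a maximum. * The values of $\mathrm{LB}$ converge to a finite limit $L$. Every subsequence of the iterates $(\{q_t^k\},\hat h)$ has a convergent subsequence, and every limit point $(\{q^{*k}_t\},h^*)$ has positive $h^*$, is a maximum (with $q(\Theta)=p_{h^*}$), and has $\mathrm{LB}=L$. -/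

import Mathlib

open MeasureTheory ProbabilityTheory Filter Topology
open scoped ENNReal

noncomputable section

namespace DecSBPR

/-! ### Stick-breaking (generalized Dirichlet) and Dirichlet laws -/

/-- The weights built from `d` sticks: `w_j = V_j * ∏_{m < j} (1 - V_m)` for `j < d`, and the last
weight is what is left of the unit interval, `∏_{m < d} (1 - V_m)` (as if the last stick were 1). -/
def stickBreak {d : ℕ} (V : Fin d → ℝ) (j : Fin (d + 1)) : ℝ :=
  (Fin.snoc V 1 : Fin (d + 1) → ℝ) j *
    ∏ m ∈ Finset.univ.filter (fun m : Fin d => m.castSucc < j), (1 - V m)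

/-- The generalized Dirichlet law: the law of the stick-breaking weights of independent sticks
`V_j ∼ Beta (σ_j, η_j)`. -/
def gdd {d : ℕ} (σ η : Fin d → ℝ) : Measure (Fin (d + 1) → ℝ) :=
  (Measure.pi fun j => betaMeasure (σ j) (η j)).map stickBreak

/-- Lebesgue measure on the open probability simplex with `m + 1` coordinates
(the first `m` coordinates are free, the last one is determined by them). -/
def simplexVolume (m : ℕ) : Measure (Fin (m + 1) → ℝ) :=
  ((volume : Measure (Fin m → ℝ)).restrict {x | (∀ i, 0 < x i) ∧ ∑ i, x i < 1}).map
    (fun x => (Fin.snoc x (1 - ∑ i, x i) : Fin (m + 1) → ℝ))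

/-- The unnormalized Dirichlet law, with density `∏ a, p_a ^ (ρ_a - 1)` on the simplex. -/
def dirichletUnnorm {m : ℕ} (ρ : Fin (m + 1) → ℝ) : Measure (Fin (m + 1) → ℝ) :=
  (simplexVolume m).withDensity (fun p => ENNReal.ofReal (∏ a, p a ^ (ρ a - 1)))

/-- The Dirichlet law `Dir (ρ)`. -/
def dirichlet {m : ℕ} (ρ : Fin (m + 1) → ℝ) : Measure (Fin (m + 1) → ℝ) :=
  (dirichletUnnorm ρ Set.univ)⁻¹ • dirichletUnnorm ρ

/-! ### The model -/

/-- Sizes of the model: the agents are `Fin numAgents` (at least one); agent `n` has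
`actM n + 1` actions, `numObs n` observations, and a controller truncated at
`sticks n + 1` nodes. -/
structure Model where
  numAgents : ℕ
  numAgents_pos : 0 < numAgents
  actM : Fin numAgents → ℕ
  numObs : Fin numAgents → ℕ
  sticks : Fin numAgents → ℕ

variable (M : Model)

abbrev Agent : Type := Fin M.numAgents
abbrev Act (n : Agent M) : Type := Fin (M.actM n + 1)
abbrev Obs (n : Agent M) : Type := Fin (M.numObs n)
abbrev Node (n : Agent M) : Type := Fin (M.sticks n + 1)

/-- Node-transition weights of one agent: `W a o i j` is the weight of going from node `i` to
node `j` after action `a` and observation `o`. -/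
abbrev Trans (n : Agent M) : Type := Act M n → Obs M n → Node M n → (Node M n → ℝ)

/-- Action weights of one agent: `π i a` is the weight of action `a` in node `i`. -/
abbrev Emis (n : Agent M) : Type := Node M n → (Act M n → ℝ)

/-- The parameters `Θ_n = (W_n, π_n)` of one agent. -/
abbrev AgentParam (n : Agent M) : Type := Trans M n × Emis M n

/-- The parameters `Θ = (Θ_1, …, Θ_N)` of all agents. -/
abbrev Param : Type := ∀ n : Agent M, AgentParam M n

/-- A node path `z_{n, 0:t}` of agent `n`. -/
abbrev Path (n : Agent M) (t : ℕ) : Type := Fin (t + 1) → Node M n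

/-- A joint node path `z_{1:N, 0:t}`. -/
abbrev JointPath (t : ℕ) : Type := ∀ n : Agent M, Path M n t

/-- Hyper-parameters `(σ, η, ρ)`: `σ, η` are attached to the sticks, `ρ` to the actions. -/
structure Hyper where
  σ : ∀ n : Agent M, Act M n → Obs M n → Node M n → Fin (M.sticks n) → ℝ
  η : ∀ n : Agent M, Act M n → Obs M n → Node M n → Fin (M.sticks n) → ℝ
  ρ : ∀ n : Agent M, Node M n → Act M n → ℝ

/-- A set of `K` episodes, episode `k` having the steps `0, …, T k` (the values of `act`, `obs`,
`reward` at later steps, and `obs` at step `0`, are never used), together with the discount `γ`,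
the reward shift `Rmin`, and strictly positive stochastic behavior policies
`behavior n h a = p^{Ψ_n}(a | h)`, where a history is the list `(a_0, o_1), …, (a_{t-1}, o_t)`. -/
structure Episodes where
  K : ℕ
  T : Fin K → ℕ
  act : Fin K → ∀ n : Agent M, ℕ → Act M n
  obs : Fin K → ∀ n : Agent M, ℕ → Obs M n
  reward : Fin K → ℕ → ℝ
  γ : ℝ
  Rmin : ℝ
  behavior : ∀ n : Agent M, List (Act M n × Obs M n) → Act M n → ℝ
  γ_nonneg : 0 ≤ γ
  γ_lt_one : γ < 1
  Rmin_le : ∀ k, ∀ t ≤ T k, Rmin ≤ reward k t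
  behavior_pos : ∀ n h a, 0 < behavior n h a
  behavior_sum : ∀ n h, ∑ a, behavior n h a = 1

variable {M}

/-- All hyper-parameters are positive. -/
def Hyper.Pos (h : Hyper M) : Prop :=
  (∀ n a o i j, 0 < h.σ n a o i j) ∧ (∀ n a o i j, 0 < h.η n a o i j) ∧ ∀ n i a, 0 < h.ρ n i a

/-- The law of `Θ_n`: independent generalized Dirichlet rows `W_{n,a,o}^{i,:}` and Dirichlet
action probabilities `π_{n,i}`. -/
def Hyper.agentLaw (h : Hyper M) (n : Agent M) : Measure (AgentParam M n) :=
  (Measure.pi fun a => Measure.pi fun o => Measure.pi fun i =>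
      gdd (h.σ n a o i) (h.η n a o i)).prod
    (Measure.pi fun i => dirichlet (h.ρ n i))

/-- The law of `Θ` with hyper-parameters `h`: a prior `p(Θ)` or a variational posterior `q(Θ)`. -/
def Hyper.law (h : Hyper M) : Measure (Param M) := Measure.pi fun n => h.agentLaw n

/-- The under-normalized parameters `Θ̃`: exponentiated expected logarithms of the parameters. -/
def Hyper.tilde (h : Hyper M) : Param M := fun n =>
  (fun a o i j => Real.exp (∫ w, Real.log (w j) ∂(gdd (h.σ n a o i) (h.η n a o i))),
    fun i a => Real.exp (∫ p, Real.log (p a) ∂(dirichlet (h.ρ n i))))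

namespace Episodes

variable (D : Episodes M)

/-- `p(a_{n,0:t}, z_{n,0:t} | o_{n,1:t}, Θ_n)` for episode `k`; the initial node is node `0`. The
formula is also used for under-normalized parameters. -/
def pathWeight (k : Fin D.K) (n : Agent M) (θ : AgentParam M n) {t : ℕ} (z : Path M n t) : ℝ :=
  (if z 0 = 0 then 1 else 0) *
    (∏ τ : Fin (t + 1), θ.2 (z τ) (D.act k n τ)) *
    ∏ τ : Fin t, θ.1 (D.act k n τ) (D.obs k n (τ + 1)) (z τ.castSucc) (z τ.succ)

/-- `p(a_{n,0:t} | o_{n,1:t}, Θ_n) = ∏_{τ ≤ t} p(a_{n,τ} | h_{n,τ}, Θ_n)`. -/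
def actWeight (k : Fin D.K) (t : ℕ) (n : Agent M) (θ : AgentParam M n) : ℝ :=
  ∑ z : Path M n t, D.pathWeight k n θ z

/-- `p(z_{n,0:t} | a_{n,0:t}, o_{n,1:t}, Θ_n)`. -/
def nodeProb (k : Fin D.K) (n : Agent M) (θ : AgentParam M n) {t : ℕ} (z : Path M n t) : ℝ :=
  D.pathWeight k n θ z / D.actWeight k t n θ

/-- The local history `h_{n,t}` in episode `k`. -/
def history (k : Fin D.K) (n : Agent M) (t : ℕ) : List (Act M n × Obs M n) :=
  List.ofFn fun τ : Fin t => (D.act k n τ, D.obs k n (τ + 1))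

/-- `∏_n ∏_{τ ≤ t} p^{Ψ_n}(a_{n,τ} | h_{n,τ})`. -/
def behaviorProb (k : Fin D.K) (t : ℕ) : ℝ :=
  ∏ n : Agent M, ∏ τ : Fin (t + 1), D.behavior n (D.history k n τ) (D.act k n τ)

/-- The discounted, shifted and importance-weighted reward
`r̃_t^k = γ^t (r_t^k - Rmin) / ∏_n ∏_τ p^{Ψ_n}(a_{n,τ} | h_{n,τ})`. -/
def rtilde (k : Fin D.K) (t : ℕ) : ℝ :=
  D.γ ^ t * (D.reward k t - D.Rmin) / D.behaviorProb k t

/-- The empirical value function `V̂(D; Θ)`. -/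
def value (θ : Param M) : ℝ :=
  ∑ k : Fin D.K, ∑ t : Fin (D.T k + 1),
    D.rtilde k t / D.K * ∏ n : Agent M, D.actWeight k t n (θ n)

/-- The marginal empirical value `V̂(D) = ∫ V̂(D; Θ) p(Θ) dΘ` under the prior `P`. -/
def marginalValue (P : Measure (Param M)) : ℝ := ∫ θ, D.value θ ∂P

/-- The re-weighted rewards `ν̂_t^k`, computed at `θ = Θ̃`. -/
def nuHat (θ : Param M) (k : Fin D.K) (t : ℕ) : ℝ :=
  D.rtilde k t * (∏ n : Agent M, D.actWeight k t n (θ n)) / D.value θ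

/-! ### The variational problem -/

/-- Families `q_t^k(z_{1:N,0:t})` of weights on joint node paths. -/
abbrev NodeWeights : Type :=
  ∀ (k : Fin D.K) (t : Fin (D.T k + 1)), JointPath M t → ℝ

variable {D} in
/-- The constraints on `q_t^k`: nonnegative, a product over the agents, total mass `K`. -/
def FeasibleNodes (q : D.NodeWeights) : Prop :=
  (∃ f : ∀ (k : Fin D.K) (t : Fin (D.T k + 1)) (n : Agent M), Path M n t → ℝ,
    (∀ k t n z, 0 ≤ f k t n z) ∧ ∀ k t z, q k t z = ∏ n, f k t n (z n)) ∧
  ∑ k : Fin D.K, ∑ t : Fin (D.T k + 1), ∑ z : JointPath M t, q k t z = D.K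

/-- The integrand of the lower bound, for episode `k`, step `t` and joint node path `z`:
`(q_t^k(z) / K) * ln (r̃_t^k p(a, z | o, Θ) p(Θ) / (q_t^k(z) q(Θ)))`, the densities being taken
with respect to the prior `P`, so that `p(Θ) / q(Θ)` is the inverse of `dQ/dP`. -/
def lbIntegrand (P : Measure (Param M)) (q : D.NodeWeights) (Q : Measure (Param M))
    (k : Fin D.K) (t : Fin (D.T k + 1)) (z : JointPath M t) (θ : Param M) : ℝ :=
  q k t z / D.K *
    Real.log (D.rtilde k t * (∏ n : Agent M, D.pathWeight k n (θ n) (z n)) /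
      (q k t z * (Q.rnDeriv P θ).toReal))

/-- The lower bound is finite: `Q` has a density, no logarithm of zero is charged, and the
integrands are integrable. (For a probability measure `Q` and nonnegative `q` the positive part of
each integrand is always integrable, so that in all other cases the bound is `-∞`.) -/
def LBFinite (P : Measure (Param M)) (q : D.NodeWeights) (Q : Measure (Param M)) : Prop :=
  Q ≪ P ∧ ∀ (k : Fin D.K) (t : Fin (D.T k + 1)) (z : JointPath M t), q k t z ≠ 0 →
    (∀ᵐ θ ∂Q, 0 < D.rtilde k t * ∏ n : Agent M, D.pathWeight k n (θ n) (z n)) ∧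
    Integrable (D.lbIntegrand P q Q k t z) Q

open scoped Classical in
/-- The variational lower bound
`LB = ∑_{k,t,z} ∫ (q_t^k(z) q(Θ) / K) ln (r̃_t^k p(a, z | o, Θ) p(Θ) / (q_t^k(z) q(Θ))) dΘ`. -/
def LB (P : Measure (Param M)) (q : D.NodeWeights) (Q : Measure (Param M)) : EReal :=
  if D.LBFinite P q Q then
    ((∑ k : Fin D.K, ∑ t : Fin (D.T k + 1), ∑ z : JointPath M t,
      ∫ θ, D.lbIntegrand P q Q k t z θ ∂Q : ℝ) : EReal)
  else ⊥

/-- The constraints on `q(Θ)`: a probability measure that is a product over the agents. -/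
def FeasibleParams (Q : Measure (Param M)) : Prop :=
  ∃ R : ∀ n : Agent M, Measure (AgentParam M n),
    (∀ n, IsProbabilityMeasure (R n)) ∧ Q = Measure.pi R

/-- `(q, Q)` is a maximum of the mean-field problem with respect to each of its two factors:
it is feasible, no feasible `q'` improves on `q` at the given `Q`, and no feasible `Q'` improves
on `Q` at the given `q`. -/
def IsVBMax (P : Measure (Param M)) (q : D.NodeWeights) (Q : Measure (Param M)) : Prop :=
  FeasibleNodes q ∧ FeasibleParams Q ∧
  (∀ q', FeasibleNodes q' → D.LB P q' Q ≤ D.LB P q Q) ∧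
  (∀ Q', FeasibleParams Q' → D.LB P q Q' ≤ D.LB P q Q)

/-! ### The updates -/

/-- The update of the node posteriors: the joint weight `ν̂_t^k ∏_n p(z_n | a_n, o_n, Θ̃_n)`, whose
marginal for agent `n` is `q_t^k(z_{n,0:t}) = ν̂_t^k p(z_{n,0:t} | a_{n,0:t}, o_{n,1:t}, Θ̃_n)`. -/
def nodeUpdate (h : Hyper M) : D.NodeWeights := fun k t z =>
  D.nuHat h.tilde k t * ∏ n : Agent M, D.nodeProb k n (h.tilde n) (z n)

/-- `ξ_{t,τ}(i, j) = p(z_τ = i, z_{τ+1} = j | a_{0:t}, o_{1:t}, Θ̃_n)`. -/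
def xi (h : Hyper M) (n : Agent M) (k : Fin D.K) (t : ℕ) (τ : Fin t) (i j : Node M n) : ℝ :=
  ∑ z : Path M n t,
    if z τ.castSucc = i ∧ z τ.succ = j then D.nodeProb k n (h.tilde n) z else 0

/-- `φ_{t,τ}(i) = p(z_τ = i | a_{0:t}, o_{1:t}, Θ̃_n)`. -/
def phi (h : Hyper M) (n : Agent M) (k : Fin D.K) (t : ℕ) (τ : Fin (t + 1)) (i : Node M n) : ℝ :=
  ∑ z : Path M n t, if z τ = i then D.nodeProb k n (h.tilde n) z else 0

/-- The reward-weighted transition counts `ζ_{n,a,o}^{i,j}`. -/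
def zeta (h : Hyper M) (n : Agent M) (a : Act M n) (o : Obs M n) (i j : Node M n) : ℝ :=
  ∑ k : Fin D.K, ∑ t : Fin (D.T k + 1), ∑ τ : Fin (t : ℕ),
    D.nuHat h.tilde k t / D.K * D.xi h n k t τ i j *
      (if D.act k n τ = a ∧ D.obs k n (τ + 1) = o then 1 else 0)

/-- The update of the hyper-parameters, with the prior hyper-parameters `h₀`. -/
def hyperUpdate (h₀ h : Hyper M) : Hyper M where
  σ n a o i j := h₀.σ n a o i j + D.zeta h n a o i j.castSucc
  η n a o i j := h₀.η n a o i j +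
    ∑ l ∈ Finset.univ.filter (fun l : Node M n => j.castSucc < l), D.zeta h n a o i l
  ρ n i a := h₀.ρ n i a +
    ∑ k : Fin D.K, ∑ t : Fin (D.T k + 1), ∑ τ : Fin ((t : ℕ) + 1),
      D.nuHat h.tilde k t / D.K * D.phi h n k t τ i * (if D.act k n τ = a then 1 else 0)

/-- The `s`-th hyper-parameters, started from `hinit`. -/
def hyperSeq (h₀ hinit : Hyper M) (s : ℕ) : Hyper M := (D.hyperUpdate h₀)^[s] hinit

/-- The `s`-th node posteriors. -/
def nodeSeq (h₀ hinit : Hyper M) (s : ℕ) : D.NodeWeights := D.nodeUpdate (D.hyperSeq h₀ hinit s)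

variable {D} in
/-- Coordinatewise convergence of a sequence of hyper-parameters and node posteriors. -/
def TendsToPoint (u : ℕ → D.NodeWeights) (v : ℕ → Hyper M) (q : D.NodeWeights) (h : Hyper M) :
    Prop :=
  (∀ k t z, Tendsto (fun s => u s k t z) atTop (𝓝 (q k t z))) ∧
  (∀ n a o i j, Tendsto (fun s => (v s).σ n a o i j) atTop (𝓝 (h.σ n a o i j))) ∧
  (∀ n a o i j, Tendsto (fun s => (v s).η n a o i j) atTop (𝓝 (h.η n a o i j))) ∧
  (∀ n i a, Tendsto (fun s => (v s).ρ n i a) atTop (𝓝 (h.ρ n i a)))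

end Episodes

end DecSBPR

end

/-! Both updates are exact maximizations of the lower bound in one factor, and one iteration is a
continuous map of the hyper-parameters into a compact box. A bounded, monotone, continuous objective
then forces every limit point to be a point that an iteration does not improve, and such points are
maxima.

Node factor. The logarithm of a path weight is a sum of logarithms of parameters, and `ln Θ̃` is the
mean of `ln Θ`. Hence the mean of the log joint weight under `p_h` is the log joint weight at `Θ̃`
(`integral_logJoint`, `LB_law`). What remains is a finite Gibbs problem; its solution is the
normalized joint weight at `Θ̃`, which is the node update (`nodeUpdate_eq`), and its value is
`bound`: `ln V̂(D; Θ̃)` minus the relative entropy of `p_h` with respect to the prior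
(`LB_nodeUpdate`, `LB_le_bound`).

Parameter factor. All laws `p_h` belong to one exponential family, with statistics `ln V`, `ln (1 -
V)` and `ln π` (`Hyper.law_eq_tilted`). Averaging the log joint weight over the updated node
posteriors gives a constant plus the score of the updated hyper-parameters
(`sum_nodeUpdate_mul_logJoint`). So the optimal parameter law is the prior tilted by this score,
that is, the updated member of the family (`LB_le_LB_hyperUpdate`). Neither comparison uses the
product form of the competitor; the unconstrained optimizers happen to be products.

Upper bound. Gibbs' inequality against the density `V̂(D; Θ) / V̂(D)` with respect to the prior
bounds every feasible value by `ln V̂(D)` (`LB_le_log_marginalValue`).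

Limits. The statistics are nonpositive, so members with halved parameters dominate all nearby ones;
means and relative entropies are therefore continuous in `h` (`IsExpFamily`). Expected counts are
nonnegative and bounded uniformly in `h`, so iterates after the first lie in a box above the prior
hyper-parameters. At a limit point both `bound h` and `bound` of the updated `h` equal the limit `L`
of the bounds, and `isVBMax_of_bound_le` applies. -/

namespace DecSBPR

/-! ### Exponential tilting -/

section Tilting

/-- Tilting by a function with non-integrable exponential gives the zero measure by convention. This
is how integrability along the whole family is obtained without computing an integral. -/
lemma integrable_exp_of_isProbabilityMeasure_tilted {X : Type*} [MeasurableSpace X]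
    {μ : Measure X} {f : X → ℝ} [hp : IsProbabilityMeasure (μ.tilted f)] :
    Integrable (fun x => Real.exp (f x)) μ := by
  by_contra h
  rw [tilted_of_not_integrable h] at hp
  exact hp.ne_zero _ rfl

/-- It suffices to test boxes. The indicator of a box factors over the coordinates, which are
independent under the product measure, so the integral factors too. -/
lemma pi_withDensity {ι : Type*} [Fintype ι] {X : ι → Type*} [∀ i, MeasurableSpace (X i)]
    (μ : ∀ i, Measure (X i)) [∀ i, IsProbabilityMeasure (μ i)] {f : ∀ i, X i → ℝ≥0∞}
    (hf : ∀ i, Measurable (f i)) [∀ i, SigmaFinite ((μ i).withDensity (f i))] :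
    Measure.pi (fun i => (μ i).withDensity (f i)) =
      (Measure.pi μ).withDensity (fun x => ∏ i, f i (x i)) := by
  refine Measure.pi_eq fun s hs => ?_
  have hind : ∀ x : ∀ i, X i, (Set.univ.pi s).indicator (fun x => ∏ i, f i (x i)) x =
      ∏ i, (s i).indicator (f i) (x i) := by
    intro x
    by_cases hx : x ∈ Set.univ.pi s
    · rw [Set.indicator_of_mem hx]
      exact Finset.prod_congr rfl fun i _ => (Set.indicator_of_mem (hx i (Set.mem_univ i)) _).symm
    · rw [Set.indicator_of_notMem hx]
      simp only [Set.mem_pi, Set.mem_univ, true_implies, not_forall] at hx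
      obtain ⟨i, hi⟩ := hx
      exact (Finset.prod_eq_zero (Finset.mem_univ i) (Set.indicator_of_notMem hi _)).symm
  rw [withDensity_apply _ (MeasurableSet.univ_pi hs),
    ← lintegral_indicator (MeasurableSet.univ_pi hs), lintegral_congr hind,
    lintegral_prod_eq_prod_lintegral_of_indepFun Finset.univ
      (fun i (x : ∀ i, X i) => (s i).indicator (f i) (x i))
      (iIndepFun_pi fun i => ((hf i).indicator (hs i)).aemeasurable)
      fun i => ((hf i).indicator (hs i)).comp (measurable_pi_apply i)]
  refine Finset.prod_congr rfl fun i _ => ?_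
  rw [withDensity_apply _ (hs i), ← lintegral_indicator (hs i),
    ← (measurePreserving_eval μ i).map_eq, lintegral_map ((hf i).indicator (hs i))
      (measurable_pi_apply i)]

/-- Exponentials of sums are products, and by Fubini so are the normalizing constants. -/
lemma pi_tilted {ι : Type*} [Fintype ι] {X : ι → Type*} [∀ i, MeasurableSpace (X i)]
    (μ : ∀ i, Measure (X i)) [∀ i, IsProbabilityMeasure (μ i)] {f : ∀ i, X i → ℝ}
    (hf : ∀ i, Measurable (f i)) [∀ i, IsProbabilityMeasure ((μ i).tilted (f i))] :
    Measure.pi (fun i => (μ i).tilted (f i)) =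
      (Measure.pi μ).tilted (fun x => ∑ i, f i (x i)) := by
  have hs : ∀ i, SigmaFinite ((μ i).withDensity
      fun x => ENNReal.ofReal (Real.exp (f i x) / ∫ x, Real.exp (f i x) ∂(μ i))) := fun i =>
    inferInstanceAs (SigmaFinite ((μ i).tilted (f i)))
  have h := pi_withDensity μ
    (f := fun i x => ENNReal.ofReal (Real.exp (f i x) / ∫ x, Real.exp (f i x) ∂(μ i)))
    (fun i => by have := hf i; fun_prop)
  refine h.trans ?_
  unfold Measure.tilted
  congr 1
  funext x
  rw [← ENNReal.ofReal_prod_of_nonneg (fun i _ => by positivity)]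
  congr 1
  simp_rw [Real.exp_sum]
  rw [integral_fintype_prod_eq_prod (fun i x => Real.exp (f i x)), Finset.prod_div_distrib]

lemma prod_tilted {X Y : Type*} [MeasurableSpace X] [MeasurableSpace Y]
    (μ : Measure X) (ν : Measure Y) [IsProbabilityMeasure μ] [IsProbabilityMeasure ν]
    {f : X → ℝ} {g : Y → ℝ} (hf : Measurable f) (hg : Measurable g)
    [IsProbabilityMeasure (μ.tilted f)] [IsProbabilityMeasure (ν.tilted g)] :
    (μ.tilted f).prod (ν.tilted g) = (μ.prod ν).tilted (fun x => f x.1 + g x.2) := by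
  have h := prod_withDensity (μ := μ) (ν := ν)
    (f := fun x => ENNReal.ofReal (Real.exp (f x) / ∫ x, Real.exp (f x) ∂μ))
    (g := fun x => ENNReal.ofReal (Real.exp (g x) / ∫ x, Real.exp (g x) ∂ν))
    (by fun_prop) (by fun_prop)
  refine h.trans ?_
  unfold Measure.tilted
  congr 1
  funext x
  rw [← ENNReal.ofReal_mul (by positivity)]
  congr 1
  simp_rw [Real.exp_add]
  rw [integral_prod_mul (fun x => Real.exp (f x)) (fun x => Real.exp (g x)), div_mul_div_comm]

/-- Carries the tilting of the independent sticks over to the weights built from them. -/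
lemma map_tilted {X Y : Type*} [MeasurableSpace X] [MeasurableSpace Y]
    (μ : Measure X) {g : X → Y} (hg : Measurable g) {f : Y → ℝ} (hf : Measurable f) :
    (μ.tilted (fun x => f (g x))).map g = (μ.map g).tilted f := by
  ext s hs
  have hm : Measurable
      (fun y => ENNReal.ofReal (Real.exp (f y) / ∫ y, Real.exp (f y) ∂(μ.map g))) := by fun_prop
  rw [Measure.map_apply hg hs, tilted_apply' _ _ (hg hs), tilted_apply' _ _ hs,
    setLIntegral_map hs hm hg,
    integral_map hg.aemeasurable (by fun_prop : Measurable fun y => Real.exp (f y)).aestronglyMeasurable]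

end Tilting

/-! ### Exponential families with nonpositive statistics -/

section ExpFamily

variable {X ι : Type*} [MeasurableSpace X] [Fintype ι]

/-- The logarithm of the unnormalized density of the member `c` with respect to the member `c₀`. -/
noncomputable def score (T : ι → X → ℝ) (c₀ c : ι → ℝ) (x : X) : ℝ := ∑ i, (c i - c₀ i) * T i x

/-- The members with positive parameters of the exponential family with statistics `T ≤ 0` are
finite; `P` is the member with parameters `c₀`. -/
structure IsExpFamily (P : Measure X) (T : ι → X → ℝ) (c₀ : ι → ℝ) : Prop where
  measurable : ∀ i, Measurable (T i)
  nonpos : ∀ᵐ x ∂P, ∀ i, T i x ≤ 0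
  integrable : ∀ c : ι → ℝ, (∀ i, 0 < c i) → Integrable (fun x => Real.exp (score T c₀ c x)) P

namespace IsExpFamily

variable {P : Measure X} {T : ι → X → ℝ} {c₀ : ι → ℝ}

lemma measurable_score (H : IsExpFamily P T c₀) (c : ι → ℝ) : Measurable (score T c₀ c) := by
  have := H.measurable
  unfold score
  fun_prop

omit [MeasurableSpace X] in
-- As `T ≤ 0`, the score decreases in each parameter. A member with smaller parameters thus
-- dominates all members above it.
lemma exp_score_le {x : X} (hx : ∀ i, T i x ≤ 0) {c c' : ι → ℝ} (h : ∀ i, c i ≤ c' i) :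
    Real.exp (score T c₀ c' x) ≤ Real.exp (score T c₀ c x) :=
  Real.exp_le_exp.2 <| Finset.sum_le_sum fun i _ =>
    mul_le_mul_of_nonpos_right (by linarith [h i]) (hx i)

omit [MeasurableSpace X] in
-- Half of the parameters is spent on absorbing the factor `|T i x|`; the other half is still
-- positive and so still gives an integrable member.
lemma abs_mul_exp_score_le {x : X} (hx : ∀ i, T i x ≤ 0) {c : ι → ℝ} (hc : ∀ i, 0 < c i) (i : ι) :
    |T i x| * Real.exp (score T c₀ c x) ≤
      2 / c i * Real.exp (score T c₀ (fun j => c j / 2) x) := by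
  have h1 : score T c₀ c x = score T c₀ (fun j => c j / 2) x + ∑ j, c j / 2 * T j x := by
    unfold score
    rw [← Finset.sum_add_distrib]
    exact Finset.sum_congr rfl fun j _ => by ring
  have h2 : ∑ j, c j / 2 * T j x ≤ c i / 2 * T i x := by
    classical
    rw [← Finset.add_sum_erase _ _ (Finset.mem_univ i)]
    have : ∑ j ∈ Finset.univ.erase i, c j / 2 * T j x ≤ 0 :=
      Finset.sum_nonpos fun j _ => mul_nonpos_of_nonneg_of_nonpos (by linarith [hc j]) (hx j)
    linarith
  -- This is `u * exp (-u) ≤ 1` at `u = c i / 2 * |T i x|`.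
  have h3 : |T i x| * Real.exp (c i / 2 * T i x) ≤ 2 / c i := by
    have hci := hc i
    have h4 : c i / 2 * |T i x| ≤ Real.exp (c i / 2 * |T i x|) := by
      linarith [Real.add_one_le_exp (c i / 2 * |T i x|)]
    have h5 : c i / 2 * T i x = -(c i / 2 * |T i x|) := by rw [abs_of_nonpos (hx i)]; ring
    rw [h5, Real.exp_neg, ← div_eq_mul_inv, div_le_div_iff₀ (Real.exp_pos _) hci]
    linarith
  rw [h1, Real.exp_add]
  calc |T i x| * (Real.exp (score T c₀ (fun j => c j / 2) x) * Real.exp (∑ j, c j / 2 * T j x))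
      ≤ |T i x| * (Real.exp (score T c₀ (fun j => c j / 2) x) * Real.exp (c i / 2 * T i x)) := by
        gcongr
    _ = |T i x| * Real.exp (c i / 2 * T i x) * Real.exp (score T c₀ (fun j => c j / 2) x) := by ring
    _ ≤ _ := by gcongr

lemma integrable_mul (H : IsExpFamily P T c₀) {c : ι → ℝ} (hc : ∀ i, 0 < c i) (i : ι) :
    Integrable (fun x => Real.exp (score T c₀ c x) * T i x) P := by
  have hm := H.measurable i
  have hs := H.measurable_score c
  refine ((H.integrable (fun j => c j / 2) fun j => half_pos (hc j)).const_mul (2 / c i)).mono'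
    (by fun_prop) ?_
  filter_upwards [H.nonpos] with x hx
  rw [norm_mul, Real.norm_eq_abs, Real.norm_eq_abs, Real.abs_exp, mul_comm]
  exact abs_mul_exp_score_le hx hc i

omit [MeasurableSpace X] in
lemma continuous_score (x : X) : Continuous fun c => score T c₀ c x := by
  unfold score; fun_prop

lemma eventually_half_le {c : ι → ℝ} (hc : ∀ i, 0 < c i) : ∀ᶠ c' in 𝓝 c, ∀ i, c i / 2 ≤ c' i := by
  refine eventually_all.2 fun i => ?_
  filter_upwards [(continuous_apply i).continuousAt.eventually (lt_mem_nhds (half_lt_self (hc i)))]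
    with c' h using h.le

/-- Dominated convergence: near `c` all parameters exceed `c / 2`, and the member `c / 2` is
integrable and dominates. -/
lemma continuousAt_integral_exp (H : IsExpFamily P T c₀) {c : ι → ℝ} (hc : ∀ i, 0 < c i) :
    ContinuousAt (fun c => ∫ x, Real.exp (score T c₀ c x) ∂P) c := by
  refine tendsto_integral_filter_of_dominated_convergence
    (fun x => Real.exp (score T c₀ (fun i => c i / 2) x)) ?_ ?_
    (H.integrable _ fun i => half_pos (hc i)) ?_
  · exact Eventually.of_forall fun c' => by have := H.measurable_score c'; fun_prop
  · filter_upwards [eventually_half_le hc] with c' hc'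
    filter_upwards [H.nonpos] with x hx
    rw [Real.norm_eq_abs, Real.abs_exp]
    exact exp_score_le hx hc'
  · exact Eventually.of_forall fun x =>
      (Real.continuous_exp.comp (continuous_score x)).continuousAt

lemma continuousAt_integral_mul (H : IsExpFamily P T c₀) {c : ι → ℝ} (hc : ∀ i, 0 < c i) (i : ι) :
    ContinuousAt (fun c => ∫ x, Real.exp (score T c₀ c x) * T i x ∂P) c := by
  have hi := H.measurable i
  refine tendsto_integral_filter_of_dominated_convergence
    (fun x => ‖Real.exp (score T c₀ (fun i => c i / 2) x) * T i x‖) ?_ ?_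
    (H.integrable_mul (fun i => half_pos (hc i)) i).norm ?_
  · exact Eventually.of_forall fun c' => by have := H.measurable_score c'; fun_prop
  · filter_upwards [eventually_half_le hc] with c' hc'
    filter_upwards [H.nonpos] with x hx
    rw [norm_mul, norm_mul, Real.norm_eq_abs, Real.norm_eq_abs (Real.exp _), Real.abs_exp,
      Real.abs_exp]
    exact mul_le_mul_of_nonneg_right (exp_score_le hx hc') (norm_nonneg _)
  · exact Eventually.of_forall fun x =>
      ((Real.continuous_exp.comp (continuous_score x)).mul continuous_const).continuousAt

lemma integrable_tilted (H : IsExpFamily P T c₀) {c : ι → ℝ} (hc : ∀ i, 0 < c i) (i : ι) :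
    Integrable (T i) (P.tilted (score T c₀ c)) :=
  (integrable_tilted_iff (H.integrable c hc) _).2 (H.integrable_mul hc i)

lemma continuousAt_mean [NeZero P] (H : IsExpFamily P T c₀) {c : ι → ℝ} (hc : ∀ i, 0 < c i)
    (i : ι) : ContinuousAt (fun c => ∫ x, T i x ∂(P.tilted (score T c₀ c))) c := by
  -- The quotient formula needs no integrability, so it holds for all `c` and not only near the
  -- given one.
  have h : (fun c => ∫ x, T i x ∂(P.tilted (score T c₀ c))) = fun c =>
      (∫ x, Real.exp (score T c₀ c x) * T i x ∂P) / ∫ x, Real.exp (score T c₀ c x) ∂P := by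
    funext c
    rw [integral_tilted, ← integral_div]
    congr 1
    funext x
    rw [smul_eq_mul]
    ring
  rw [h]
  exact (H.continuousAt_integral_mul hc i).div (H.continuousAt_integral_exp hc)
    (integral_exp_pos (H.integrable c hc)).ne'

lemma integrable_score (H : IsExpFamily P T c₀) {c : ι → ℝ} (hc : ∀ i, 0 < c i) (c' : ι → ℝ) :
    Integrable (score T c₀ c') (P.tilted (score T c₀ c)) := by
  unfold score
  exact integrable_finsetSum _ fun i _ => (H.integrable_tilted hc i).const_mul _

/-- The relative entropy of the member `c` with respect to `P` is continuous in `c`. -/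
lemma continuousAt_entropy [NeZero P] (H : IsExpFamily P T c₀) {c : ι → ℝ} (hc : ∀ i, 0 < c i) :
    ContinuousAt (fun c => ∫ x, score T c₀ c x ∂(P.tilted (score T c₀ c)) -
      Real.log (∫ x, Real.exp (score T c₀ c x) ∂P)) c := by
  have hpos : ∀ᶠ c' in 𝓝 c, ∀ i, 0 < c' i := by
    filter_upwards [eventually_half_le hc] with c' h i using (half_pos (hc i)).trans_le (h i)
  have h1 : ContinuousAt (fun c => ∑ i, (c i - c₀ i) * ∫ x, T i x ∂(P.tilted (score T c₀ c))) c :=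
    tendsto_finsetSum _ fun i _ => ((continuous_apply i).continuousAt.sub
      continuousAt_const).mul (H.continuousAt_mean hc i)
  refine ContinuousAt.sub (h1.congr ?_) ((H.continuousAt_integral_exp hc).log
    (integral_exp_pos (H.integrable c hc)).ne')
  filter_upwards [hpos] with c' hc'
  simp only [score]
  rw [integral_finsetSum _ fun i _ => (H.integrable_tilted hc' i).const_mul _]
  simp only [integral_const_mul]

end IsExpFamily

end ExpFamily

/-! ### Gibbs' inequality -/

/-- Integrating `g / (dQ/dP)` against `Q` returns at most the `P`-mass of `g`, which is at most 1.
The pointwise hypothesis is what `ln x ≤ x - 1` yields, kept in this form so that `f` may be an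
average of many logarithms. -/
lemma integral_nonpos_of_le_div_rnDeriv_sub_one {X : Type*} [MeasurableSpace X] {P Q : Measure X}
    [IsProbabilityMeasure P] [IsProbabilityMeasure Q] (hQP : Q ≪ P) {f g : X → ℝ}
    (hg : Measurable g) (hg0 : ∀ᵐ x ∂P, 0 ≤ g x) (hgP : Integrable g P) (hg1 : ∫ x, g x ∂P ≤ 1)
    (hf : Integrable f Q) (hfg : ∀ᵐ x ∂Q, f x ≤ g x / (Q.rnDeriv P x).toReal - 1) :
    ∫ x, f x ∂Q ≤ 0 := by
  have hl : ∫⁻ x, ENNReal.ofReal (g x / (Q.rnDeriv P x).toReal) ∂Q ≤ 1 := by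
    have hm : Measurable fun x => ENNReal.ofReal (g x / (Q.rnDeriv P x).toReal) :=
      (hg.div (Q.measurable_rnDeriv P).ennreal_toReal).ennreal_ofReal
    rw [← lintegral_rnDeriv_mul hQP hm.aemeasurable]
    calc ∫⁻ x, Q.rnDeriv P x * ENNReal.ofReal (g x / (Q.rnDeriv P x).toReal) ∂P
        ≤ ∫⁻ x, ENNReal.ofReal (g x) ∂P := by
          refine lintegral_mono_ae ?_
          filter_upwards [Q.rnDeriv_lt_top P, hg0] with x hx hgx
          -- Where `dQ/dP` vanishes the left side is 0 and the mass of `g` is lost; hence an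
          -- inequality.
          rcases eq_or_ne (Q.rnDeriv P x) 0 with h0 | h0
          · simp [h0]
          · have hp := ENNReal.toReal_pos h0 hx.ne
            rw [ENNReal.ofReal_div_of_pos hp, ENNReal.ofReal_toReal hx.ne,
              ENNReal.mul_div_cancel h0 hx.ne]
      _ = ENNReal.ofReal (∫ x, g x ∂P) := (ofReal_integral_eq_lintegral_ofReal hgP hg0).symm
      _ ≤ 1 := by simpa using ENNReal.ofReal_le_ofReal hg1
  have hm : AEStronglyMeasurable (fun x => g x / (Q.rnDeriv P x).toReal) Q :=
    (hg.div (Q.measurable_rnDeriv P).ennreal_toReal).aestronglyMeasurable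
  have h0 : 0 ≤ᵐ[Q] fun x => g x / (Q.rnDeriv P x).toReal := by
    filter_upwards [hQP.ae_le hg0] with x hx using div_nonneg hx ENNReal.toReal_nonneg
  have hi : Integrable (fun x => g x / (Q.rnDeriv P x).toReal) Q :=
    (lintegral_ofReal_ne_top_iff_integrable hm h0).1 (hl.trans_lt ENNReal.one_lt_top).ne
  have h1 : ∫ x, g x / (Q.rnDeriv P x).toReal ∂Q ≤ 1 := by
    rw [integral_eq_lintegral_of_nonneg_ae h0 hm]
    exact ENNReal.toReal_le_of_le_ofReal zero_le_one (by simpa using hl)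
  calc ∫ x, f x ∂Q ≤ ∫ x, (g x / (Q.rnDeriv P x).toReal - 1) ∂Q :=
        integral_mono_ae hf (hi.sub (integrable_const 1)) hfg
    _ = ∫ x, g x / (Q.rnDeriv P x).toReal ∂Q - 1 := by
        rw [integral_sub hi (integrable_const 1)]; simp
    _ ≤ 0 := by linarith

/-! ### Beta laws -/

/-- Total mass 1 forces the integral of `exp F` to be finite and nonzero, and `a` to be its inverse.
So only density ratios up to a constant have to be computed below. -/
lemma eq_tilted_of_eq_smul_withDensity {X : Type*} [MeasurableSpace X] {μ ν : Measure X}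
    [hν : IsProbabilityMeasure ν] {F : X → ℝ} (hF : Measurable F) {a : ℝ≥0∞}
    (h : ν = a • μ.withDensity fun x => ENNReal.ofReal (Real.exp (F x))) : ν = μ.tilted F := by
  have hm : Measurable fun x => ENNReal.ofReal (Real.exp (F x)) := by fun_prop
  have h1 : a * ∫⁻ x, ENNReal.ofReal (Real.exp (F x)) ∂μ = 1 := by
    have := hν.measure_univ
    rwa [h, Measure.smul_apply, withDensity_apply _ MeasurableSet.univ, setLIntegral_univ,
      smul_eq_mul] at this
  have hfin : ∫⁻ x, ENNReal.ofReal (Real.exp (F x)) ∂μ ≠ ∞ := by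
    intro ht
    rw [ht] at h1
    rcases eq_or_ne a 0 with h0 | h0
    · simp [h0] at h1
    · rw [ENNReal.mul_top h0] at h1
      exact ENNReal.top_ne_one h1
  have h0 : 0 ≤ᵐ[μ] fun x => Real.exp (F x) := Eventually.of_forall fun x => (Real.exp_pos _).le
  have hint : Integrable (fun x => Real.exp (F x)) μ :=
    (lintegral_ofReal_ne_top_iff_integrable (by fun_prop) h0).1 hfin
  have hZ := ofReal_integral_eq_lintegral_ofReal hint h0
  have ha : a = (ENNReal.ofReal (∫ x, Real.exp (F x) ∂μ))⁻¹ := by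
    rw [hZ]; exact ENNReal.eq_inv_of_mul_eq_one_left h1
  have hμ : NeZero μ := ⟨fun h0 => by simp [h0] at h1⟩
  rw [h, ha, ← withDensity_smul _ hm]
  unfold Measure.tilted
  congr 1
  funext x
  rw [ENNReal.ofReal_div_of_pos (integral_exp_pos hint), Pi.smul_apply, smul_eq_mul,
    ENNReal.div_eq_inv_mul]

lemma measurable_betaPDF (a b : ℝ) : Measurable (betaPDF a b) :=
  (measurable_betaPDFReal a b).ennreal_ofReal

/-- On `(0, 1)` the ratio of the densities is `x ^ (a' - a) * (1 - x) ^ (b' - b)` up to a constant;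
elsewhere both vanish. -/
lemma betaMeasure_eq_tilted {a b a' b' : ℝ} (ha : 0 < a) (hb : 0 < b) (ha' : 0 < a')
    (hb' : 0 < b') : betaMeasure a' b' =
      (betaMeasure a b).tilted fun x => (a' - a) * Real.log x + (b' - b) * Real.log (1 - x) := by
  have := isProbabilityMeasureBeta ha' hb'
  have hF : Measurable fun x : ℝ => (a' - a) * Real.log x + (b' - b) * Real.log (1 - x) := by
    fun_prop
  have hm : Measurable fun x : ℝ =>
    ENNReal.ofReal (Real.exp ((a' - a) * Real.log x + (b' - b) * Real.log (1 - x))) := by fun_prop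
  refine eq_tilted_of_eq_smul_withDensity hF (a := ENNReal.ofReal (beta a b / beta a' b')) ?_
  unfold betaMeasure
  rw [← withDensity_mul _ (measurable_betaPDF a b) hm,
    ← withDensity_smul _ ((measurable_betaPDF a b).mul hm)]
  congr 1
  funext x
  rw [Pi.smul_apply, Pi.mul_apply, smul_eq_mul]
  by_cases hx : 0 < x ∧ x < 1
  · have hx0 := hx.1
    have hx1 : 0 < 1 - x := by linarith [hx.2]
    have hB := beta_pos ha hb
    have hB' := beta_pos ha' hb'
    rw [betaPDF_of_pos_lt_one hx.1 hx.2, betaPDF_of_pos_lt_one hx.1 hx.2,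
      ← ENNReal.ofReal_mul (by positivity), ← ENNReal.ofReal_mul (by positivity)]
    congr 1
    rw [Real.exp_add, mul_comm (a' - a), mul_comm (b' - b), ← Real.rpow_def_of_pos hx.1,
      ← Real.rpow_def_of_pos hx1]
    have e1 : x ^ (a' - 1) = x ^ (a - 1) * x ^ (a' - a) := by
      rw [← Real.rpow_add hx.1]; congr 1; ring
    have e2 : (1 - x) ^ (b' - 1) = (1 - x) ^ (b - 1) * (1 - x) ^ (b' - b) := by
      rw [← Real.rpow_add hx1]; congr 1; ring
    rw [e1, e2]
    field_simp
  · simp [betaPDF_eq, hx]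

lemma ae_betaMeasure_mem_Ioo (a b : ℝ) : ∀ᵐ x ∂(betaMeasure a b), x ∈ Set.Ioo (0 : ℝ) 1 := by
  refine (ae_withDensity_iff (measurable_betaPDF a b)).2 (Eventually.of_forall fun x hx => ?_)
  by_contra h
  exact hx (by rw [betaPDF_eq, if_neg (show ¬(0 < x ∧ x < 1) from h), ENNReal.ofReal_zero])

/-! ### Stick breaking -/

/-- The sticks of a row of stick-breaking weights. -/
noncomputable def stick {d : ℕ} (w : Fin (d + 1) → ℝ) (j : Fin d) : ℝ :=
  w j.castSucc / (1 - ∑ m ∈ Finset.univ.filter (fun m : Fin (d + 1) => m < j.castSucc), w m)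

lemma measurable_stick {d : ℕ} (j : Fin d) : Measurable fun w : Fin (d + 1) → ℝ => stick w j := by
  unfold stick; fun_prop

lemma measurable_stickBreak {d : ℕ} : Measurable (stickBreak (d := d)) := by
  refine measurable_pi_lambda _ fun j => ?_
  unfold stickBreak
  refine Measurable.mul ?_ (by fun_prop)
  induction j using Fin.lastCases with
  | last => simp
  | cast j => simpa using measurable_pi_apply j

/-- What is left after the first breaks: each break removes the fraction `V j` of the remainder and
so multiplies it by `1 - V j`. -/
lemma one_sub_sum_stickBreak {d : ℕ} (V : Fin d → ℝ) (j : Fin (d + 1)) :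
    1 - ∑ m ∈ Finset.univ.filter (fun m : Fin (d + 1) => m < j), stickBreak V m =
      ∏ m ∈ Finset.univ.filter (fun m : Fin d => m.castSucc < j), (1 - V m) := by
  induction j using Fin.induction with
  | zero => simp
  | succ j ih =>
    have e1 : Finset.univ.filter (fun m : Fin (d + 1) => m < j.succ) =
        insert j.castSucc (Finset.univ.filter (fun m : Fin (d + 1) => m < j.castSucc)) := by
      ext m
      simp only [Finset.mem_filter, Finset.mem_univ, true_and, Finset.mem_insert, Fin.lt_def,
        Fin.ext_iff, Fin.val_succ, Fin.val_castSucc]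
      omega
    have e2 : Finset.univ.filter (fun m : Fin d => m.castSucc < j.succ) =
        insert j (Finset.univ.filter (fun m : Fin d => m.castSucc < j.castSucc)) := by
      ext m
      simp only [Finset.mem_filter, Finset.mem_univ, true_and, Finset.mem_insert, Fin.lt_def,
        Fin.ext_iff, Fin.val_succ, Fin.val_castSucc]
      omega
    rw [e1, e2, Finset.sum_insert (by simp), Finset.prod_insert (by simp), ← ih]
    have e3 : stickBreak V j.castSucc = V j * (1 - ∑ m ∈ Finset.univ.filter
        (fun m : Fin (d + 1) => m < j.castSucc), stickBreak V m) := by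
      rw [ih]; simp [stickBreak]
    rw [e3]; ring

lemma stick_stickBreak {d : ℕ} {V : Fin d → ℝ} (hV : ∀ j, V j < 1) (j : Fin d) :
    stick (stickBreak V) j = V j := by
  have h : ∏ m ∈ Finset.univ.filter (fun m : Fin d => m.castSucc < j.castSucc), (1 - V m) ≠ 0 :=
    (Finset.prod_pos fun m _ => by linarith [hV m]).ne'
  rw [stick, one_sub_sum_stickBreak, stickBreak, Fin.snoc_castSucc, mul_div_assoc, div_self h,
    mul_one]

lemma stickBreak_pos {d : ℕ} {V : Fin d → ℝ} (hV : ∀ j, V j ∈ Set.Ioo (0 : ℝ) 1)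
    (j : Fin (d + 1)) : 0 < stickBreak V j := by
  refine mul_pos ?_ (Finset.prod_pos fun m _ => by linarith [(hV m).2])
  induction j using Fin.lastCases with
  | last => simp
  | cast j => simpa using (hV j).1

lemma stickBreak_le_one {d : ℕ} {V : Fin d → ℝ} (hV : ∀ j, V j ∈ Set.Ioo (0 : ℝ) 1)
    (j : Fin (d + 1)) : stickBreak V j ≤ 1 := by
  refine mul_le_one₀ ?_ (Finset.prod_nonneg fun m _ => by linarith [(hV m).2])
    (Finset.prod_le_one (fun m _ => by linarith [(hV m).2]) fun m _ => by linarith [(hV m).1])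
  induction j using Fin.lastCases with
  | last => simp
  | cast j => simpa using (hV j).2.le

/-- Log weights are linear in the statistics of the Beta family with 0-1 coefficients, which is the
source of conjugacy. The last weight has no term `ln V`, its stick being 1. -/
lemma log_stickBreak {d : ℕ} {V : Fin d → ℝ} (hV : ∀ j, V j ∈ Set.Ioo (0 : ℝ) 1)
    (j : Fin (d + 1)) : Real.log (stickBreak V j) =
      ∑ i : Fin d, ((if i.castSucc = j then 1 else 0) * Real.log (V i) +
        (if i.castSucc < j then 1 else 0) * Real.log (1 - V i)) := by
  have h : ∀ m, 0 < 1 - V m := fun m => by linarith [(hV m).2]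
  have hs : (Fin.snoc V 1 : Fin (d + 1) → ℝ) j ≠ 0 := by
    induction j using Fin.lastCases with
    | last => simp
    | cast j => simpa using (hV j).1.ne'
  rw [stickBreak, Real.log_mul hs (Finset.prod_pos fun m _ => h m).ne',
    Real.log_prod fun m _ => (h m).ne', Finset.sum_add_distrib, Finset.sum_filter]
  congr 1
  · induction j using Fin.lastCases with
    | last => simp [Fin.castSucc_ne_last]
    | cast j => simp
  · exact Finset.sum_congr rfl fun i _ => by split_ifs <;> simp

lemma isProbabilityMeasure_gdd {d : ℕ} {σ η : Fin d → ℝ} (hσ : ∀ j, 0 < σ j) (hη : ∀ j, 0 < η j) :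
    IsProbabilityMeasure (gdd σ η) := by
  have := fun j => isProbabilityMeasureBeta (hσ j) (hη j)
  exact Measure.isProbabilityMeasure_map measurable_stickBreak.aemeasurable

/-- Almost every row arises from sticks in `(0, 1)`, on which `stick` inverts `stickBreak`; the
statistics can therefore be read off from the weights. -/
lemma ae_gdd {d : ℕ} {σ η : Fin d → ℝ} (hσ : ∀ j, 0 < σ j) (hη : ∀ j, 0 < η j) :
    ∀ᵐ w ∂(gdd σ η), (∀ j, stick w j ∈ Set.Ioo (0 : ℝ) 1) ∧ stickBreak (stick w) = w := by
  have := fun j => isProbabilityMeasureBeta (hσ j) (hη j)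
  have hst : Measurable (stick (d := d)) := measurable_pi_lambda _ measurable_stick
  refine (ae_map_iff measurable_stickBreak.aemeasurable ?_).2 ?_
  · have h : MeasurableSet ((⋂ j, (fun w : Fin (d + 1) → ℝ => stick w j) ⁻¹' Set.Ioo 0 1) ∩
        {w | stickBreak (stick w) = w}) :=
      (MeasurableSet.iInter fun j => (measurable_stick j) measurableSet_Ioo).inter
        (measurableSet_eq_fun (measurable_stickBreak.comp hst) measurable_id)
    convert h using 1
    ext w
    simp
  · filter_upwards [ae_all_iff.2 fun j => (measurePreserving_eval (fun j => betaMeasure (σ j) (η j))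
      j).quasiMeasurePreserving.ae (ae_betaMeasure_mem_Ioo (σ j) (η j))] with V hV
    have h : stick (stickBreak V) = V := funext fun j => stick_stickBreak (fun j => (hV j).2) j
    rw [h]
    exact ⟨hV, rfl⟩

/-- Tilt the independent Beta laws, and push forward; the score is a function of the weights because
the sticks are. -/
lemma gdd_eq_tilted {d : ℕ} {σ η σ' η' : Fin d → ℝ} (hσ : ∀ j, 0 < σ j) (hη : ∀ j, 0 < η j)
    (hσ' : ∀ j, 0 < σ' j) (hη' : ∀ j, 0 < η' j) :
    gdd σ' η' = (gdd σ η).tilted fun w => ∑ j, ((σ' j - σ j) * Real.log (stick w j) +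
      (η' j - η j) * Real.log (1 - stick w j)) := by
  have hp := fun j => isProbabilityMeasureBeta (hσ j) (hη j)
  have hp' := fun j => isProbabilityMeasureBeta (hσ' j) (hη' j)
  have hm : Measurable fun w : Fin (d + 1) → ℝ => ∑ j, ((σ' j - σ j) * Real.log (stick w j) +
      (η' j - η j) * Real.log (1 - stick w j)) := by
    have := fun j => measurable_stick (d := d) j
    fun_prop
  unfold gdd
  rw [← map_tilted _ measurable_stickBreak hm]
  congr 1
  have he : (fun j => betaMeasure (σ' j) (η' j)) = fun j => (betaMeasure (σ j) (η j)).tilted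
      fun x => (σ' j - σ j) * Real.log x + (η' j - η j) * Real.log (1 - x) :=
    funext fun j => betaMeasure_eq_tilted (hσ j) (hη j) (hσ' j) (hη' j)
  have hp'' : ∀ j, IsProbabilityMeasure ((betaMeasure (σ j) (η j)).tilted
      fun x => (σ' j - σ j) * Real.log x + (η' j - η j) * Real.log (1 - x)) := fun j => by
    rw [← betaMeasure_eq_tilted (hσ j) (hη j) (hσ' j) (hη' j)]; exact hp' j
  rw [he, pi_tilted _ fun j => by fun_prop]
  refine tilted_congr ?_
  filter_upwards [ae_all_iff.2 fun j => (measurePreserving_eval (fun j => betaMeasure (σ j) (η j))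
      j).quasiMeasurePreserving.ae (ae_betaMeasure_mem_Ioo (σ j) (η j))] with V hV
  exact Finset.sum_congr rfl fun j _ => by rw [stick_stickBreak fun j => (hV j).2]

/-! ### Dirichlet laws -/

lemma lintegral_scaled_beta {s a b : ℝ} (hs : 0 < s) (ha : 0 < a) (hb : 0 < b) :
    ∫⁻ u, (Set.Ioo 0 s).indicator (fun u => ENNReal.ofReal (u ^ (a - 1) * (s - u) ^ (b - 1))) u =
      ENNReal.ofReal (s ^ (a + b - 1) * beta a b) := by
  have hm : Measurable ((Set.Ioo 0 s).indicator
      (fun u => ENNReal.ofReal (u ^ (a - 1) * (s - u) ^ (b - 1)))) :=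
    Measurable.indicator (by fun_prop) measurableSet_Ioo
  have hB := beta_pos ha hb
  -- Substitution `u = s * v`. The two powers contribute `s ^ (a + b - 2)`; the missing factor `s`
  -- is the Jacobian.
  have hp : ∀ v, (Set.Ioo 0 s).indicator
      (fun u => ENNReal.ofReal (u ^ (a - 1) * (s - u) ^ (b - 1))) (s * v) =
      ENNReal.ofReal (s ^ (a + b - 2) * beta a b) * betaPDF a b v := by
    intro v
    by_cases hv : 0 < v ∧ v < 1
    · have hv1 : 0 < 1 - v := by linarith [hv.2]
      rw [Set.indicator_of_mem (show s * v ∈ Set.Ioo 0 s from ⟨mul_pos hs hv.1, by nlinarith [hv.2]⟩),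
        betaPDF_of_pos_lt_one hv.1 hv.2, ← ENNReal.ofReal_mul (by positivity)]
      congr 1
      rw [show s - s * v = s * (1 - v) by ring, Real.mul_rpow hs.le hv.1.le,
        Real.mul_rpow hs.le hv1.le, show a + b - 2 = (a - 1) + (b - 1) by ring, Real.rpow_add hs]
      field_simp
    · rw [betaPDF_eq, if_neg hv, ENNReal.ofReal_zero, mul_zero]
      refine Set.indicator_of_notMem (fun h => hv ⟨?_, ?_⟩) _
      · exact pos_of_mul_pos_right h.1 hs.le
      · by_contra hv'
        nlinarith [h.2, not_lt.1 hv']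
  rw [← Real.smul_map_volume_mul_left hs.ne', lintegral_smul_measure,
    lintegral_map hm (measurable_const_mul s), lintegral_congr hp,
    lintegral_const_mul _ (measurable_betaPDF a b), lintegral_betaPDF_eq_one ha hb, mul_one,
    smul_eq_mul, ← ENNReal.ofReal_mul (abs_nonneg s), abs_of_pos hs, ← mul_assoc]
  congr 2
  rw [show a + b - 1 = 1 + (a + b - 2) by ring, Real.rpow_add hs, Real.rpow_one]

/-- The free coordinates of the open probability simplex. -/
def openSimplex (m : ℕ) : Set (Fin m → ℝ) := {x | (∀ i, 0 < x i) ∧ ∑ i, x i < 1}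

lemma measurableSet_openSimplex (m : ℕ) : MeasurableSet (openSimplex m) := by
  have h : MeasurableSet ((⋂ i, {x : Fin m → ℝ | 0 < x i}) ∩ {x | ∑ i, x i < 1}) :=
    (MeasurableSet.iInter fun i => measurableSet_lt measurable_const (measurable_pi_apply i)).inter
      (measurableSet_lt (by fun_prop) measurable_const)
  convert h using 1
  ext x
  simp [openSimplex]

/-- The Dirichlet integral is positive and finite. -/
lemma exists_lintegral_dirichlet {m : ℕ} (ρ : Fin m → ℝ) (r : ℝ) (hρ : ∀ i, 0 < ρ i) (hr : 0 < r) :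
    ∃ c : ℝ, 0 < c ∧ ∫⁻ x, (openSimplex m).indicator
      (fun x => ENNReal.ofReal ((∏ i, x i ^ (ρ i - 1)) * (1 - ∑ i, x i) ^ (r - 1))) x =
        ENNReal.ofReal c := by
  induction m generalizing r with
  | zero =>
    refine ⟨1, one_pos, ?_⟩
    have : (openSimplex 0) = Set.univ := by ext; simp [openSimplex]
    simp [this, volume_pi]
  | succ m ih =>
    -- Integrating out the first coordinate over `(0, s)`, with `s` one minus the sum of the others,
    -- gives `s ^ (ρ 0 + r - 1) * beta (ρ 0) r`. The induction thus passes to the remainder exponent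
    -- `ρ 0 + r`.
    obtain ⟨c, hc, h⟩ := ih (fun i => ρ i.succ) (ρ 0 + r) (fun i => hρ _) (add_pos (hρ 0) hr)
    have hB := beta_pos (hρ 0) hr
    refine ⟨c * beta (ρ 0) r, by positivity, ?_⟩
    have hm : Measurable ((openSimplex (m + 1)).indicator (fun x => ENNReal.ofReal
        ((∏ i, x i ^ (ρ i - 1)) * (1 - ∑ i, x i) ^ (r - 1)))) :=
      Measurable.indicator (by fun_prop) (measurableSet_openSimplex _)
    have hm' : Measurable ((openSimplex m).indicator (fun x => ENNReal.ofReal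
        ((∏ i, x i ^ (ρ i.succ - 1)) * (1 - ∑ i, x i) ^ (ρ 0 + r - 1)))) :=
      Measurable.indicator (by fun_prop) (measurableSet_openSimplex _)
    have e := volume_preserving_piFinSuccAbove (fun _ : Fin (m + 1) => ℝ) 0
    rw [MeasurePreserving.lintegral_map_equiv _ _ e.symm]
    have hmc := hm.comp (MeasurableEquiv.piFinSuccAbove (fun _ : Fin (m + 1) => ℝ) 0).symm.measurable
    rw [Measure.volume_eq_prod]
    refine (lintegral_prod_symm _ hmc.aemeasurable).trans ?_
    have hy : ∀ y : Fin m → ℝ, ∫⁻ u : ℝ, (openSimplex (m + 1)).indicator (fun x => ENNReal.ofReal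
        ((∏ i, x i ^ (ρ i - 1)) * (1 - ∑ i, x i) ^ (r - 1))) (Fin.cons u y) =
        (openSimplex m).indicator (fun x => ENNReal.ofReal
        ((∏ i, x i ^ (ρ i.succ - 1)) * (1 - ∑ i, x i) ^ (ρ 0 + r - 1))) y *
          ENNReal.ofReal (beta (ρ 0) r) := by
      intro y
      by_cases hyS : y ∈ openSimplex m
      · have hs : 0 < 1 - ∑ i, y i := by linarith [hyS.2]
        have hprod : 0 ≤ ∏ i, y i ^ (ρ i.succ - 1) :=
          Finset.prod_nonneg fun i _ => Real.rpow_nonneg (hyS.1 i).le _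
        have hu : ∀ u : ℝ, (openSimplex (m + 1)).indicator (fun x => ENNReal.ofReal
            ((∏ i, x i ^ (ρ i - 1)) * (1 - ∑ i, x i) ^ (r - 1))) (Fin.cons u y) =
            ENNReal.ofReal (∏ i, y i ^ (ρ i.succ - 1)) * (Set.Ioo 0 (1 - ∑ i, y i)).indicator
              (fun u => ENNReal.ofReal (u ^ (ρ 0 - 1) * (1 - ∑ i, y i - u) ^ (r - 1))) u := by
          intro u
          by_cases hu : u ∈ Set.Ioo 0 (1 - ∑ i, y i)
          · have hmem : (Fin.cons u y : Fin (m + 1) → ℝ) ∈ openSimplex (m + 1) := by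
              refine ⟨fun i => ?_, ?_⟩
              · refine Fin.cases ?_ (fun i => ?_) i
                · simpa using hu.1
                · simpa using hyS.1 i
              · rw [Fin.sum_univ_succ]; simp only [Fin.cons_zero, Fin.cons_succ]; linarith [hu.2]
            rw [Set.indicator_of_mem hu, Set.indicator_of_mem hmem, ← ENNReal.ofReal_mul hprod]
            congr 1
            rw [Fin.prod_univ_succ, Fin.sum_univ_succ]
            simp only [Fin.cons_zero, Fin.cons_succ]
            rw [show 1 - (u + ∑ i, y i) = 1 - ∑ i, y i - u by ring]
            ring
          · rw [Set.indicator_of_notMem hu, mul_zero]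
            refine Set.indicator_of_notMem (fun h => hu ⟨by simpa using h.1 0, ?_⟩) _
            have := h.2
            rw [Fin.sum_univ_succ] at this
            simp only [Fin.cons_zero, Fin.cons_succ] at this
            linarith
        rw [lintegral_congr hu, lintegral_const_mul' _ _ ENNReal.ofReal_ne_top,
          lintegral_scaled_beta hs (hρ 0) hr, Set.indicator_of_mem hyS,
          ← ENNReal.ofReal_mul hprod, ← ENNReal.ofReal_mul (by positivity)]
        congr 1
        ring
      · rw [Set.indicator_of_notMem hyS, zero_mul]
        -- Dropping a positive coordinate leaves a point of the smaller simplex, so over any other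
        -- `y` the slice is empty.
        refine (lintegral_congr fun u => Set.indicator_of_notMem (fun h => hyS ⟨fun i => ?_, ?_⟩)
          _).trans lintegral_zero
        · simpa using h.1 i.succ
        · have h0 := h.1 0
          have := h.2
          rw [Fin.sum_univ_succ] at this
          simp only [Fin.cons_zero, Fin.cons_succ] at this h0
          linarith
    simp only [MeasurableEquiv.piFinSuccAbove_symm_apply, Fin.insertNthEquiv_zero]
    refine (lintegral_congr hy).trans ?_
    rw [lintegral_mul_const _ hm', h, ← ENNReal.ofReal_mul hc.le]

lemma measurable_simplexEmbed (m : ℕ) : Measurable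
    (fun x : Fin m → ℝ => (Fin.snoc x (1 - ∑ i, x i) : Fin (m + 1) → ℝ)) := by
  refine measurable_pi_lambda _ fun j => ?_
  induction j using Fin.lastCases with
  | last => simp only [Fin.snoc_last]; fun_prop
  | cast j => simpa using measurable_pi_apply j

lemma ae_simplexVolume (m : ℕ) : ∀ᵐ p ∂(simplexVolume m), ∀ a, 0 < p a ∧ p a ≤ 1 := by
  refine (ae_map_iff (measurable_simplexEmbed m).aemeasurable ?_).2
    (ae_restrict_of_forall_mem (measurableSet_openSimplex m) fun x hx a => ?_)
  · simp only [Set.ofPred_forall]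
    exact MeasurableSet.iInter fun a => (measurableSet_lt measurable_const
      (measurable_pi_apply a)).inter (measurableSet_le (measurable_pi_apply a) measurable_const)
  · induction a using Fin.lastCases with
    | last =>
      have := Finset.sum_nonneg fun i (_ : i ∈ Finset.univ) => (hx.1 i).le
      simp only [Fin.snoc_last]
      exact ⟨by linarith [hx.2], by linarith⟩
    | cast a =>
      have := Finset.single_le_sum (fun i _ => (hx.1 i).le) (Finset.mem_univ a)
      simp only [Fin.snoc_castSucc]
      exact ⟨hx.1 a, by linarith [hx.2]⟩

lemma measurable_dirichletDensity {m : ℕ} (ρ : Fin (m + 1) → ℝ) :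
    Measurable fun p : Fin (m + 1) → ℝ => ENNReal.ofReal (∏ a, p a ^ (ρ a - 1)) := by fun_prop

/-- Makes the normalization of the Dirichlet law meaningful; the value of the constant plays no
role. -/
lemma dirichletUnnorm_univ {m : ℕ} {ρ : Fin (m + 1) → ℝ} (hρ : ∀ a, 0 < ρ a) :
    dirichletUnnorm ρ Set.univ ≠ 0 ∧ dirichletUnnorm ρ Set.univ ≠ ∞ := by
  obtain ⟨c, hc, h⟩ := exists_lintegral_dirichlet (fun i : Fin m => ρ i.castSucc) (ρ (Fin.last m))
    (fun i => hρ _) (hρ _)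
  have : dirichletUnnorm ρ Set.univ = ENNReal.ofReal c := by
    rw [← h, dirichletUnnorm, withDensity_apply _ MeasurableSet.univ, setLIntegral_univ,
      simplexVolume, lintegral_map (measurable_dirichletDensity ρ) (measurable_simplexEmbed m),
      lintegral_indicator (measurableSet_openSimplex m)]
    refine lintegral_congr fun x => ?_
    rw [Fin.prod_univ_castSucc]
    simp
  rw [this]
  exact ⟨by simpa using hc, ENNReal.ofReal_ne_top⟩

lemma isProbabilityMeasure_dirichlet {m : ℕ} {ρ : Fin (m + 1) → ℝ} (hρ : ∀ a, 0 < ρ a) :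
    IsProbabilityMeasure (dirichlet ρ) := by
  obtain ⟨h0, h1⟩ := dirichletUnnorm_univ hρ
  exact ⟨by rw [dirichlet, Measure.smul_apply, smul_eq_mul, ENNReal.inv_mul_cancel h0 h1]⟩

lemma ae_dirichlet {m : ℕ} (ρ : Fin (m + 1) → ℝ) :
    ∀ᵐ p ∂(dirichlet ρ), ∀ a, 0 < p a ∧ p a ≤ 1 :=
  Measure.ae_smul_measure ((withDensity_absolutelyContinuous _ _).ae_le (ae_simplexVolume m)) _

lemma dirichlet_eq_tilted {m : ℕ} {ρ ρ' : Fin (m + 1) → ℝ} (hρ : ∀ a, 0 < ρ a)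
    (hρ' : ∀ a, 0 < ρ' a) : dirichlet ρ' =
      (dirichlet ρ).tilted fun p => ∑ a, (ρ' a - ρ a) * Real.log (p a) := by
  have := isProbabilityMeasure_dirichlet hρ'
  obtain ⟨h0, h1⟩ := dirichletUnnorm_univ hρ
  have hm : Measurable fun p : Fin (m + 1) → ℝ =>
    ENNReal.ofReal (Real.exp (∑ a, (ρ' a - ρ a) * Real.log (p a))) := by fun_prop
  have hd : dirichletUnnorm ρ' = (dirichletUnnorm ρ).withDensity
      fun p => ENNReal.ofReal (Real.exp (∑ a, (ρ' a - ρ a) * Real.log (p a))) := by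
    unfold dirichletUnnorm
    rw [← withDensity_mul _ (measurable_dirichletDensity ρ) hm]
    refine withDensity_congr_ae ?_
    filter_upwards [ae_simplexVolume m] with p hp
    rw [Pi.mul_apply, ← ENNReal.ofReal_mul
      (Finset.prod_nonneg fun a _ => Real.rpow_nonneg (hp a).1.le _), Real.exp_sum,
      ← Finset.prod_mul_distrib]
    congr 1
    refine Finset.prod_congr rfl fun a _ => ?_
    rw [mul_comm (ρ' a - ρ a), ← Real.rpow_def_of_pos (hp a).1, ← Real.rpow_add (hp a).1]
    congr 1
    ring
  -- The constant removes the normalization of the old law and installs that of the new one.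
  refine eq_tilted_of_eq_smul_withDensity (by fun_prop)
    (a := (dirichletUnnorm ρ' Set.univ)⁻¹ * dirichletUnnorm ρ Set.univ) ?_
  unfold dirichlet
  rw [withDensity_smul_measure, ← hd, smul_smul, mul_assoc, ENNReal.mul_inv_cancel h0 h1, mul_one]

/-! ### Products of tilted laws -/

lemma pi_eq_tilted {ι : Type*} [Fintype ι] {X : ι → Type*} [∀ i, MeasurableSpace (X i)]
    {μ ν : ∀ i, Measure (X i)} [∀ i, IsProbabilityMeasure (μ i)] [∀ i, IsProbabilityMeasure (ν i)]
    {f : ∀ i, X i → ℝ} (hf : ∀ i, Measurable (f i)) (h : ∀ i, ν i = (μ i).tilted (f i)) :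
    Measure.pi ν = (Measure.pi μ).tilted (fun x => ∑ i, f i (x i)) := by
  have : ∀ i, IsProbabilityMeasure ((μ i).tilted (f i)) := fun i => h i ▸ inferInstance
  rw [← pi_tilted μ hf, funext h]

lemma prod_eq_tilted {X Y : Type*} [MeasurableSpace X] [MeasurableSpace Y]
    {μ μ' : Measure X} {ν ν' : Measure Y} [IsProbabilityMeasure μ] [IsProbabilityMeasure ν]
    [IsProbabilityMeasure μ'] [IsProbabilityMeasure ν']
    {f : X → ℝ} {g : Y → ℝ} (hf : Measurable f) (hg : Measurable g)
    (hμ : μ' = μ.tilted f) (hν : ν' = ν.tilted g) :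
    μ'.prod ν' = (μ.prod ν).tilted (fun x => f x.1 + g x.2) := by
  have : IsProbabilityMeasure (μ.tilted f) := hμ ▸ inferInstance
  have : IsProbabilityMeasure (ν.tilted g) := hν ▸ inferInstance
  rw [hμ, hν, prod_tilted μ ν hf hg]

lemma pi_pi_pi_eq_tilted {A O I X : Type*} [Fintype A] [Fintype O] [Fintype I] [MeasurableSpace X]
    {μ ν : A → O → I → Measure X} [∀ a o i, IsProbabilityMeasure (μ a o i)]
    [∀ a o i, IsProbabilityMeasure (ν a o i)] {f : A → O → I → X → ℝ}
    (hf : ∀ a o i, Measurable (f a o i)) (h : ∀ a o i, ν a o i = (μ a o i).tilted (f a o i)) :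
    (Measure.pi fun a => Measure.pi fun o => Measure.pi fun i => ν a o i) =
      (Measure.pi fun a => Measure.pi fun o => Measure.pi fun i => μ a o i).tilted
        fun W => ∑ a, ∑ o, ∑ i, f a o i (W a o i) := by
  have h1 := fun a o => pi_eq_tilted (hf a o) (h a o)
  have m1 := fun a o => (show Measurable fun W : I → X => ∑ i, f a o i (W i) by fun_prop)
  have h2 := fun a => pi_eq_tilted (m1 a) (h1 a)
  have m2 := fun a => (show Measurable fun W : O → I → X => ∑ o, ∑ i, f a o i (W o i) by fun_prop)
  have e := pi_eq_tilted m2 h2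
  exact e

/-! ### The laws of the parameters as an exponential family -/

variable {M : Model}

/-- Indices of the sticks. -/
abbrev StickIx (M : Model) : Type := Σ n : Agent M, Act M n × Obs M n × Node M n × Fin (M.sticks n)

/-- Indices of the action weights. -/
abbrev EmisIx (M : Model) : Type := Σ n : Agent M, Node M n × Act M n

/-- Indices of the hyper-parameters. -/
abbrev HyperIx (M : Model) : Type := (StickIx M ⊕ StickIx M) ⊕ EmisIx M

/-- The hyper-parameters as a vector. -/
def Hyper.vec (h : Hyper M) : HyperIx M → ℝ :=
  Sum.elim (Sum.elim (fun x => h.σ x.1 x.2.1 x.2.2.1 x.2.2.2.1 x.2.2.2.2)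
    (fun x => h.η x.1 x.2.1 x.2.2.1 x.2.2.2.1 x.2.2.2.2)) (fun x => h.ρ x.1 x.2.1 x.2.2)

/-- The hyper-parameters with a given vector. -/
def Hyper.ofVec (c : HyperIx M → ℝ) : Hyper M where
  σ n a o i j := c (Sum.inl (Sum.inl ⟨n, a, o, i, j⟩))
  η n a o i j := c (Sum.inl (Sum.inr ⟨n, a, o, i, j⟩))
  ρ n i a := c (Sum.inr ⟨n, i, a⟩)

lemma Hyper.vec_ofVec (c : HyperIx M → ℝ) : (Hyper.ofVec c).vec = c := by
  funext x
  rcases x with (x | x) | x <;> rfl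

lemma Hyper.pos_iff_vec {h : Hyper M} : h.Pos ↔ ∀ x, 0 < h.vec x := by
  constructor
  · rintro ⟨h1, h2, h3⟩ ((x | x) | x)
    · exact h1 _ _ _ _ _
    · exact h2 _ _ _ _ _
    · exact h3 _ _ _
  · exact fun H => ⟨fun n a o i j => H (Sum.inl (Sum.inl ⟨n, a, o, i, j⟩)),
      fun n a o i j => H (Sum.inl (Sum.inr ⟨n, a, o, i, j⟩)), fun n i a => H (Sum.inr ⟨n, i, a⟩)⟩

/-- The statistics of the exponential family: logarithms of the sticks, of their complements, and
of the action weights. -/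
noncomputable def logStat : HyperIx M → Param M → ℝ :=
  Sum.elim
    (Sum.elim (fun x θ => Real.log (stick ((θ x.1).1 x.2.1 x.2.2.1 x.2.2.2.1) x.2.2.2.2))
      (fun x θ => Real.log (1 - stick ((θ x.1).1 x.2.1 x.2.2.1 x.2.2.2.1) x.2.2.2.2)))
    (fun x θ => Real.log ((θ x.1).2 x.2.1 x.2.2))

/-- Groups the score by agents and rows, as the product structure of the law requires. -/
lemma score_logStat (c₀ c : Hyper M) (θ : Param M) : score logStat c₀.vec c.vec θ =
    ∑ n, ((∑ a, ∑ o, ∑ i, ∑ j,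
      ((c.σ n a o i j - c₀.σ n a o i j) * Real.log (stick ((θ n).1 a o i) j) +
        (c.η n a o i j - c₀.η n a o i j) * Real.log (1 - stick ((θ n).1 a o i) j))) +
      ∑ i, ∑ a, (c.ρ n i a - c₀.ρ n i a) * Real.log ((θ n).2 i a)) := by
  simp only [score, Fintype.sum_sum_type, Fintype.sum_sigma, Fintype.sum_prod_type,
    Finset.sum_add_distrib, Hyper.vec, logStat, Sum.elim_inl, Sum.elim_inr]

namespace Hyper

lemma Pos.isProbabilityMeasure_gdd {h : Hyper M} (hp : h.Pos) (n : Agent M) (a : Act M n)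
    (o : Obs M n) (i : Node M n) : IsProbabilityMeasure (gdd (h.σ n a o i) (h.η n a o i)) :=
  DecSBPR.isProbabilityMeasure_gdd (hp.1 n a o i) (hp.2.1 n a o i)

lemma Pos.isProbabilityMeasure_dirichlet {h : Hyper M} (hp : h.Pos) (n : Agent M)
    (i : Node M n) : IsProbabilityMeasure (dirichlet (h.ρ n i)) :=
  DecSBPR.isProbabilityMeasure_dirichlet (hp.2.2 n i)

lemma Pos.isProbabilityMeasure_agentLaw {h : Hyper M} (hp : h.Pos) (n : Agent M) :
    IsProbabilityMeasure (h.agentLaw n) := by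
  have := hp.isProbabilityMeasure_gdd n
  have := hp.isProbabilityMeasure_dirichlet n
  unfold agentLaw
  infer_instance

lemma Pos.isProbabilityMeasure_law {h : Hyper M} (hp : h.Pos) : IsProbabilityMeasure h.law := by
  have := hp.isProbabilityMeasure_agentLaw
  unfold law
  infer_instance

/-- The logarithmic density ratio of the transition rows of one agent. -/
noncomputable def transScore (h₀ h : Hyper M) (n : Agent M) (W : Trans M n) : ℝ :=
  ∑ a, ∑ o, ∑ i, ∑ j, ((h.σ n a o i j - h₀.σ n a o i j) * Real.log (stick (W a o i) j) +
    (h.η n a o i j - h₀.η n a o i j) * Real.log (1 - stick (W a o i) j))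

/-- The logarithmic density ratio of the action weights of one agent. -/
noncomputable def emisScore (h₀ h : Hyper M) (n : Agent M) (π : Emis M n) : ℝ :=
  ∑ i, ∑ a, (h.ρ n i a - h₀.ρ n i a) * Real.log (π i a)

lemma measurable_transScore (h₀ h : Hyper M) (n : Agent M) : Measurable (transScore h₀ h n) := by
  have := fun j => measurable_stick (d := M.sticks n) j
  unfold transScore
  fun_prop

lemma measurable_emisScore (h₀ h : Hyper M) (n : Agent M) : Measurable (emisScore h₀ h n) := by
  unfold emisScore
  fun_prop

lemma transLaw_eq_tilted {h₀ h : Hyper M} (hp₀ : h₀.Pos) (hp : h.Pos) (n : Agent M) :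
    (Measure.pi fun a => Measure.pi fun o => Measure.pi fun i => gdd (h.σ n a o i) (h.η n a o i)) =
      (Measure.pi fun a => Measure.pi fun o => Measure.pi fun i =>
        gdd (h₀.σ n a o i) (h₀.η n a o i)).tilted (transScore h₀ h n) := by
  have := hp₀.isProbabilityMeasure_gdd
  have := hp.isProbabilityMeasure_gdd
  have hst := fun j => measurable_stick (d := M.sticks n) j
  exact pi_pi_pi_eq_tilted (f := fun a o i w => ∑ j,
    ((h.σ n a o i j - h₀.σ n a o i j) * Real.log (stick w j) +
      (h.η n a o i j - h₀.η n a o i j) * Real.log (1 - stick w j)))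
    (fun a o i => by fun_prop) fun a o i =>
      gdd_eq_tilted (hp₀.1 n a o i) (hp₀.2.1 n a o i) (hp.1 n a o i) (hp.2.1 n a o i)

lemma emisLaw_eq_tilted {h₀ h : Hyper M} (hp₀ : h₀.Pos) (hp : h.Pos) (n : Agent M) :
    (Measure.pi fun i => dirichlet (h.ρ n i)) =
      (Measure.pi fun i => dirichlet (h₀.ρ n i)).tilted (emisScore h₀ h n) := by
  have := hp₀.isProbabilityMeasure_dirichlet
  have := hp.isProbabilityMeasure_dirichlet
  have hm := fun i => (show Measurable fun p : Act M n → ℝ =>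
    ∑ a, (h.ρ n i a - h₀.ρ n i a) * Real.log (p a) by fun_prop)
  have e := pi_eq_tilted hm fun i => dirichlet_eq_tilted (hp₀.2.2 n i) (hp.2.2 n i)
  exact e

lemma agentLaw_eq_tilted {h₀ h : Hyper M} (hp₀ : h₀.Pos) (hp : h.Pos) (n : Agent M) :
    h.agentLaw n = (h₀.agentLaw n).tilted
      fun θ => transScore h₀ h n θ.1 + emisScore h₀ h n θ.2 := by
  have := hp₀.isProbabilityMeasure_gdd n
  have := hp₀.isProbabilityMeasure_dirichlet n
  have := hp.isProbabilityMeasure_gdd n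
  have := hp.isProbabilityMeasure_dirichlet n
  exact prod_eq_tilted (measurable_transScore h₀ h n) (measurable_emisScore h₀ h n)
    (transLaw_eq_tilted hp₀ hp n) (emisLaw_eq_tilted hp₀ hp n)

/-- Assembles the Beta and Dirichlet tiltings through the product over rows and agents: prior and
all variational laws lie in a single exponential family. -/
lemma law_eq_tilted {h₀ h : Hyper M} (hp₀ : h₀.Pos) (hp : h.Pos) :
    h.law = h₀.law.tilted (score logStat h₀.vec h.vec) := by
  have := hp₀.isProbabilityMeasure_agentLaw
  have := hp.isProbabilityMeasure_agentLaw
  rw [funext (score_logStat h₀ h)]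
  have hm := fun n => ((measurable_transScore h₀ h n).comp measurable_fst).add
      ((measurable_emisScore h₀ h n).comp measurable_snd)
  have e := pi_eq_tilted hm (agentLaw_eq_tilted hp₀ hp)
  exact e

lemma Pos.measurePreserving_trans {h : Hyper M} (hp : h.Pos) (n : Agent M) (a : Act M n)
    (o : Obs M n) (i : Node M n) : MeasurePreserving (fun θ : Param M => (θ n).1 a o i) h.law
      (gdd (h.σ n a o i) (h.η n a o i)) := by
  have := hp.isProbabilityMeasure_gdd
  have := hp.isProbabilityMeasure_dirichlet
  have := hp.isProbabilityMeasure_agentLaw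
  exact (measurePreserving_eval (fun i => gdd (h.σ n a o i) (h.η n a o i)) i).comp
    ((measurePreserving_eval (fun o => Measure.pi fun i => gdd (h.σ n a o i) (h.η n a o i)) o).comp
      ((measurePreserving_eval (fun a => Measure.pi fun o => Measure.pi fun i =>
        gdd (h.σ n a o i) (h.η n a o i)) a).comp
          (measurePreserving_fst.comp (measurePreserving_eval h.agentLaw n))))

lemma Pos.measurePreserving_emis {h : Hyper M} (hp : h.Pos) (n : Agent M) (i : Node M n) :
    MeasurePreserving (fun θ : Param M => (θ n).2 i) h.law (dirichlet (h.ρ n i)) := by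
  have := hp.isProbabilityMeasure_gdd
  have := hp.isProbabilityMeasure_dirichlet
  have := hp.isProbabilityMeasure_agentLaw
  exact (measurePreserving_eval (fun i => dirichlet (h.ρ n i)) i).comp
    (measurePreserving_snd.comp (measurePreserving_eval h.agentLaw n))

end Hyper

/-- Parameters whose rows come from sticks in `(0, 1)`, and whose action weights are in `(0, 1]`. -/
structure Regular (θ : Param M) : Prop where
  stick_mem : ∀ n a o i j, stick ((θ n).1 a o i) j ∈ Set.Ioo (0 : ℝ) 1
  stickBreak_eq : ∀ n a o i, stickBreak (stick ((θ n).1 a o i)) = (θ n).1 a o i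
  emis_mem : ∀ n i a, 0 < (θ n).2 i a ∧ (θ n).2 i a ≤ 1

namespace Regular

variable {θ : Param M}

lemma logStat_nonpos (hθ : Regular θ) (x : HyperIx M) : logStat x θ ≤ 0 := by
  rcases x with (x | x) | x
  · have h := hθ.stick_mem x.1 x.2.1 x.2.2.1 x.2.2.2.1 x.2.2.2.2
    exact Real.log_nonpos h.1.le h.2.le
  · have h := hθ.stick_mem x.1 x.2.1 x.2.2.1 x.2.2.2.1 x.2.2.2.2
    exact Real.log_nonpos (by linarith [h.2]) (by linarith [h.1])
  · have h := hθ.emis_mem x.1 x.2.1 x.2.2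
    exact Real.log_nonpos h.1.le h.2

lemma trans_pos (hθ : Regular θ) (n : Agent M) (a : Act M n) (o : Obs M n) (i j : Node M n) :
    0 < (θ n).1 a o i j := by
  rw [← hθ.stickBreak_eq n a o i]; exact stickBreak_pos (hθ.stick_mem n a o i) j

lemma trans_le_one (hθ : Regular θ) (n : Agent M) (a : Act M n) (o : Obs M n) (i j : Node M n) :
    (θ n).1 a o i j ≤ 1 := by
  rw [← hθ.stickBreak_eq n a o i]; exact stickBreak_le_one (hθ.stick_mem n a o i) j

lemma log_trans (hθ : Regular θ) (n : Agent M) (a : Act M n) (o : Obs M n) (i j : Node M n) :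
    Real.log ((θ n).1 a o i j) = ∑ l : Fin (M.sticks n),
      ((if l.castSucc = j then 1 else 0) * Real.log (stick ((θ n).1 a o i) l) +
        (if l.castSucc < j then 1 else 0) * Real.log (1 - stick ((θ n).1 a o i) l)) := by
  rw [← log_stickBreak (hθ.stick_mem n a o i) j, hθ.stickBreak_eq]

end Regular

/-! ### The exponential family of the laws, and expected logarithms -/

namespace Hyper

lemma Pos.ae_regular {h : Hyper M} (hp : h.Pos) : ∀ᵐ θ ∂h.law, Regular θ := by
  have h1 : ∀ᵐ θ ∂h.law, ∀ n a o i, (∀ j, stick ((θ n).1 a o i) j ∈ Set.Ioo (0 : ℝ) 1) ∧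
      stickBreak (stick ((θ n).1 a o i)) = (θ n).1 a o i :=
    ae_all_iff.2 fun n => ae_all_iff.2 fun a => ae_all_iff.2 fun o => ae_all_iff.2 fun i =>
      (hp.measurePreserving_trans n a o i).quasiMeasurePreserving.ae
        (ae_gdd (hp.1 n a o i) (hp.2.1 n a o i))
  have h2 : ∀ᵐ θ ∂h.law, ∀ n i, ∀ a, 0 < (θ n).2 i a ∧ (θ n).2 i a ≤ 1 :=
    ae_all_iff.2 fun n => ae_all_iff.2 fun i =>
      (hp.measurePreserving_emis n i).quasiMeasurePreserving.ae (ae_dirichlet _)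
  filter_upwards [h1, h2] with θ h1 h2
  exact ⟨fun n a o i => (h1 n a o i).1, fun n a o i => (h1 n a o i).2, h2⟩

lemma measurable_logStat (x : HyperIx M) : Measurable (logStat x) := by
  have hst := fun (n : Agent M) j => measurable_stick (d := M.sticks n) j
  rcases x with (⟨n, a, o, i, j⟩ | ⟨n, a, o, i, j⟩) | ⟨n, i, a⟩
  · have := hst n j
    simp only [logStat, Sum.elim_inl]
    fun_prop
  · have := hst n j
    simp only [logStat, Sum.elim_inl, Sum.elim_inr]
    fun_prop
  · simp only [logStat, Sum.elim_inr]
    fun_prop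

/-- Integrability at `c` holds because the law with hyper-parameters `c` is already known to be a
probability measure, and it is a tilting of the prior. -/
lemma Pos.isExpFamily {h₀ : Hyper M} (hp₀ : h₀.Pos) : IsExpFamily h₀.law logStat h₀.vec where
  measurable := measurable_logStat
  nonpos := by filter_upwards [hp₀.ae_regular] with θ hθ using hθ.logStat_nonpos
  integrable c hc := by
    have hp : (ofVec c).Pos := pos_iff_vec.2 (by rwa [vec_ofVec])
    have h := hp.isProbabilityMeasure_law
    rw [law_eq_tilted hp₀ hp, vec_ofVec] at h
    exact integrable_exp_of_isProbabilityMeasure_tilted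

lemma Pos.integrable_logStat {h : Hyper M} (hp : h.Pos) (x : HyperIx M) :
    Integrable (logStat x) h.law := by
  -- The law is viewed as the member at the base point of its own family.
  rw [law_eq_tilted hp hp]
  exact hp.isExpFamily.integrable_tilted (pos_iff_vec.1 hp) x

lemma Pos.integrable_log_emis {h : Hyper M} (hp : h.Pos) (n : Agent M) (i : Node M n)
    (a : Act M n) : Integrable (fun θ : Param M => Real.log ((θ n).2 i a)) h.law :=
  hp.integrable_logStat (Sum.inr ⟨n, i, a⟩)

lemma Pos.log_trans_ae {h : Hyper M} (hp : h.Pos) (n : Agent M) (a : Act M n)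
    (o : Obs M n) (i j : Node M n) : (fun θ : Param M => Real.log ((θ n).1 a o i j)) =ᵐ[h.law]
      fun θ => ∑ l : Fin (M.sticks n),
        ((if l.castSucc = j then 1 else 0) * logStat (Sum.inl (Sum.inl ⟨n, a, o, i, l⟩)) θ +
          (if l.castSucc < j then 1 else 0) * logStat (Sum.inl (Sum.inr ⟨n, a, o, i, l⟩)) θ) := by
  filter_upwards [hp.ae_regular] with θ hθ using hθ.log_trans n a o i j

lemma Pos.integrable_log_trans {h : Hyper M} (hp : h.Pos) (n : Agent M) (a : Act M n)
    (o : Obs M n) (i j : Node M n) :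
    Integrable (fun θ : Param M => Real.log ((θ n).1 a o i j)) h.law :=
  (integrable_finsetSum _ fun _ _ => ((hp.integrable_logStat _).const_mul _).add
    ((hp.integrable_logStat _).const_mul _)).congr (hp.log_trans_ae n a o i j).symm

lemma Pos.tilde_trans {h : Hyper M} (hp : h.Pos) (n : Agent M) (a : Act M n)
    (o : Obs M n) (i j : Node M n) : (h.tilde n).1 a o i j =
      Real.exp (∫ θ, Real.log ((θ n).1 a o i j) ∂h.law) := by
  have e := hp.measurePreserving_trans n a o i
  have hm : Measurable fun w : Node M n → ℝ => Real.log (w j) := by fun_prop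
  unfold tilde
  dsimp only
  rw [← e.map_eq, integral_map e.measurable.aemeasurable hm.aestronglyMeasurable]

lemma Pos.tilde_emis {h : Hyper M} (hp : h.Pos) (n : Agent M) (i : Node M n) (a : Act M n) :
    (h.tilde n).2 i a = Real.exp (∫ θ, Real.log ((θ n).2 i a) ∂h.law) := by
  have e := hp.measurePreserving_emis n i
  have hm : Measurable fun w : Act M n → ℝ => Real.log (w a) := by fun_prop
  unfold tilde
  dsimp only
  rw [← e.map_eq, integral_map e.measurable.aemeasurable hm.aestronglyMeasurable]

/-- The relative entropy of the law with hyper-parameters `h` with respect to the prior. -/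
noncomputable def relEntropy (h₀ h : Hyper M) : ℝ :=
  ∫ θ, score logStat h₀.vec h.vec θ ∂h.law -
    Real.log (∫ θ, Real.exp (score logStat h₀.vec h.vec θ) ∂h₀.law)

/-! ### Continuity in the hyper-parameters -/

section Continuity

variable {α : Type*} {l : Filter α} {v : α → Hyper M} {h : Hyper M}

/-- Continuity of means in the exponential family based at the limit law itself, so no prior is
involved. -/
lemma tendsto_integral_logStat (hp : h.Pos) (hv : ∀ᶠ s in l, (v s).Pos)
    (hl : Tendsto (fun s => (v s).vec) l (𝓝 h.vec)) (x : HyperIx M) :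
    Tendsto (fun s => ∫ θ, logStat x θ ∂(v s).law) l (𝓝 (∫ θ, logStat x θ ∂h.law)) := by
  have := hp.isProbabilityMeasure_law
  rw [law_eq_tilted hp hp]
  refine ((hp.isExpFamily.continuousAt_mean (pos_iff_vec.1 hp) x).tendsto.comp hl).congr' ?_
  filter_upwards [hv] with s hs
  rw [law_eq_tilted hp hs]
  rfl

lemma tendsto_relEntropy {h₀ : Hyper M} (hp₀ : h₀.Pos) (hp : h.Pos) (hv : ∀ᶠ s in l, (v s).Pos)
    (hl : Tendsto (fun s => (v s).vec) l (𝓝 h.vec)) :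
    Tendsto (fun s => relEntropy h₀ (v s)) l (𝓝 (relEntropy h₀ h)) := by
  have := hp₀.isProbabilityMeasure_law
  unfold relEntropy
  rw [law_eq_tilted hp₀ hp]
  refine ((hp₀.isExpFamily.continuousAt_entropy (pos_iff_vec.1 hp)).tendsto.comp hl).congr' ?_
  filter_upwards [hv] with s hs
  rw [law_eq_tilted hp₀ hs]
  rfl

lemma tendsto_tilde_emis (hp : h.Pos) (hv : ∀ᶠ s in l, (v s).Pos)
    (hl : Tendsto (fun s => (v s).vec) l (𝓝 h.vec)) (n : Agent M) (i : Node M n) (a : Act M n) :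
    Tendsto (fun s => ((v s).tilde n).2 i a) l (𝓝 ((h.tilde n).2 i a)) := by
  rw [hp.tilde_emis]
  refine ((Real.continuous_exp.tendsto _).comp
    (tendsto_integral_logStat hp hv hl (Sum.inr ⟨n, i, a⟩))).congr' ?_
  filter_upwards [hv] with s hs
  rw [hs.tilde_emis]
  rfl

lemma Pos.integral_log_trans (hp : h.Pos) (n : Agent M) (a : Act M n)
    (o : Obs M n) (i j : Node M n) : ∫ θ, Real.log ((θ n).1 a o i j) ∂h.law =
      ∑ l : Fin (M.sticks n), ((if l.castSucc = j then 1 else 0) *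
          ∫ θ, logStat (Sum.inl (Sum.inl ⟨n, a, o, i, l⟩)) θ ∂h.law +
        (if l.castSucc < j then 1 else 0) *
          ∫ θ, logStat (Sum.inl (Sum.inr ⟨n, a, o, i, l⟩)) θ ∂h.law) := by
  rw [integral_congr_ae (hp.log_trans_ae n a o i j)]
  refine (integral_finsetSum _ fun l _ => ((hp.integrable_logStat _).const_mul _).add
    ((hp.integrable_logStat _).const_mul _)).trans ?_
  refine Finset.sum_congr rfl fun l _ => ?_
  rw [integral_add' ((hp.integrable_logStat _).const_mul _) ((hp.integrable_logStat _).const_mul _),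
    integral_const_mul, integral_const_mul]

lemma tendsto_tilde_trans (hp : h.Pos) (hv : ∀ᶠ s in l, (v s).Pos)
    (hl : Tendsto (fun s => (v s).vec) l (𝓝 h.vec)) (n : Agent M) (a : Act M n)
    (o : Obs M n) (i j : Node M n) :
    Tendsto (fun s => ((v s).tilde n).1 a o i j) l (𝓝 ((h.tilde n).1 a o i j)) := by
  rw [hp.tilde_trans, hp.integral_log_trans]
  refine ((Real.continuous_exp.tendsto _).comp (tendsto_finsetSum _ fun m _ =>
    ((tendsto_integral_logStat hp hv hl _).const_mul _).add
      ((tendsto_integral_logStat hp hv hl _).const_mul _))).congr' ?_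
  filter_upwards [hv] with s hs
  rw [hs.tilde_trans, hs.integral_log_trans]
  rfl

lemma tendsto_tilde (hp : h.Pos) (hv : ∀ᶠ s in l, (v s).Pos)
    (hl : Tendsto (fun s => (v s).vec) l (𝓝 h.vec)) :
    Tendsto (fun s => (v s).tilde) l (𝓝 h.tilde) := by
  refine tendsto_pi_nhds.2 fun n => Tendsto.prodMk_nhds ?_ ?_
  · exact tendsto_pi_nhds.2 fun a => tendsto_pi_nhds.2 fun o => tendsto_pi_nhds.2 fun i =>
      tendsto_pi_nhds.2 fun j => tendsto_tilde_trans hp hv hl n a o i j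
  · exact tendsto_pi_nhds.2 fun i => tendsto_pi_nhds.2 fun a => tendsto_tilde_emis hp hv hl n i a

end Continuity

end Hyper

/-! ### Path weights of positive parameters -/

/-- All the weights are positive. -/
structure PosParam (θ : Param M) : Prop where
  trans_pos : ∀ n a o i j, 0 < (θ n).1 a o i j
  emis_pos : ∀ n i a, 0 < (θ n).2 i a

lemma Regular.posParam {θ : Param M} (hθ : Regular θ) : PosParam θ :=
  ⟨hθ.trans_pos, fun n i a => (hθ.emis_mem n i a).1⟩

lemma Hyper.posParam_tilde (h : Hyper M) : PosParam h.tilde :=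
  ⟨fun _ _ _ _ _ => Real.exp_pos _, fun _ _ _ => Real.exp_pos _⟩

namespace Episodes

variable (D : Episodes M)

/-- The logarithm of the weight of a path that starts in node `0`. -/
noncomputable def pathLog (k : Fin D.K) (n : Agent M) (θ : AgentParam M n) {t : ℕ} (z : Path M n t) : ℝ :=
  ∑ τ : Fin (t + 1), Real.log (θ.2 (z τ) (D.act k n τ)) +
    ∑ τ : Fin t, Real.log (θ.1 (D.act k n τ) (D.obs k n (τ + 1)) (z τ.castSucc) (z τ.succ))

/-- The logarithm of `r̃_t^k p(a, z | o, Θ)` for paths that start in node `0`. -/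
noncomputable def logJoint (k : Fin D.K) {t : ℕ} (z : JointPath M t) (θ : Param M) : ℝ :=
  Real.log (D.rtilde k t) + ∑ n, D.pathLog k n (θ n) (z n)

variable {D}

section PosParam

variable {θ : Param M} (hθ : PosParam θ) (k : Fin D.K) (n : Agent M) {t : ℕ}
include hθ

lemma pathWeight_nonneg (z : Path M n t) : 0 ≤ D.pathWeight k n (θ n) z :=
  mul_nonneg (mul_nonneg (by split_ifs <;> simp)
    (Finset.prod_nonneg fun _ _ => (hθ.emis_pos _ _ _).le))
    (Finset.prod_nonneg fun _ _ => (hθ.trans_pos _ _ _ _ _).le)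

lemma pathWeight_pos {z : Path M n t} (hz : z 0 = 0) : 0 < D.pathWeight k n (θ n) z := by
  rw [pathWeight, if_pos hz, one_mul]
  exact mul_pos (Finset.prod_pos fun _ _ => hθ.emis_pos _ _ _)
    (Finset.prod_pos fun _ _ => hθ.trans_pos _ _ _ _ _)

lemma log_pathWeight {z : Path M n t} (hz : z 0 = 0) :
    Real.log (D.pathWeight k n (θ n) z) = D.pathLog k n (θ n) z := by
  rw [pathWeight, if_pos hz, one_mul, Real.log_mul
    (Finset.prod_pos fun _ _ => hθ.emis_pos _ _ _).ne'
    (Finset.prod_pos fun _ _ => hθ.trans_pos _ _ _ _ _).ne',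
    Real.log_prod fun _ _ => (hθ.emis_pos _ _ _).ne',
    Real.log_prod fun _ _ => (hθ.trans_pos _ _ _ _ _).ne', pathLog]

/-- The path that stays in node 0 has positive weight. -/
lemma actWeight_pos (t : ℕ) : 0 < D.actWeight k t n (θ n) :=
  Finset.sum_pos' (fun z _ => pathWeight_nonneg hθ k n z)
    ⟨fun _ => 0, Finset.mem_univ _, pathWeight_pos hθ k n rfl⟩

lemma nodeProb_nonneg (z : Path M n t) : 0 ≤ D.nodeProb k n (θ n) z :=
  div_nonneg (pathWeight_nonneg hθ k n z) (actWeight_pos hθ k n t).le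

lemma sum_nodeProb (t : ℕ) : ∑ z : Path M n t, D.nodeProb k n (θ n) z = 1 := by
  simp only [nodeProb]
  rw [← Finset.sum_div]
  exact div_self (actWeight_pos hθ k n t).ne'

end PosParam

lemma eq_zero_of_pathWeight_ne_zero {k : Fin D.K} {n : Agent M}
    {θ : AgentParam M n} {t : ℕ} {z : Path M n t} (h : D.pathWeight k n θ z ≠ 0) : z 0 = 0 := by
  by_contra hz
  exact h (by rw [pathWeight, if_neg hz, zero_mul, zero_mul])

lemma pathWeight_le_one {θ : Param M} (hθ : Regular θ) (k : Fin D.K) (n : Agent M) {t : ℕ}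
    (z : Path M n t) : D.pathWeight k n (θ n) z ≤ 1 := by
  have h1 : ∏ τ : Fin (t + 1), (θ n).2 (z τ) (D.act k n τ) ≤ 1 :=
    Finset.prod_le_one (fun _ _ => (hθ.emis_mem _ _ _).1.le) fun _ _ => (hθ.emis_mem _ _ _).2
  have h2 : ∏ τ : Fin t, (θ n).1 (D.act k n τ) (D.obs k n (τ + 1)) (z τ.castSucc) (z τ.succ) ≤ 1 :=
    Finset.prod_le_one (fun _ _ => (hθ.trans_pos _ _ _ _ _).le) fun _ _ => hθ.trans_le_one _ _ _ _ _
  have h3 := Finset.prod_nonneg fun (τ : Fin (t + 1)) (_ : τ ∈ Finset.univ) =>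
    (hθ.emis_mem n (z τ) (D.act k n τ)).1.le
  have h4 := Finset.prod_nonneg fun (τ : Fin t) (_ : τ ∈ Finset.univ) =>
    (hθ.trans_pos n (D.act k n τ) (D.obs k n (τ + 1)) (z τ.castSucc) (z τ.succ)).le
  unfold pathWeight
  refine mul_le_one₀ (mul_le_one₀ (by split_ifs <;> simp) h3 h1) h4 h2

/-! ### The empirical value -/

variable (D)

lemma behaviorProb_pos (k : Fin D.K) (t : ℕ) : 0 < D.behaviorProb k t :=
  Finset.prod_pos fun _ _ => Finset.prod_pos fun _ _ => D.behavior_pos _ _ _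

lemma rtilde_nonneg (k : Fin D.K) (t : Fin (D.T k + 1)) : 0 ≤ D.rtilde k t :=
  div_nonneg (mul_nonneg (pow_nonneg D.γ_nonneg _)
    (sub_nonneg.2 (D.Rmin_le k t (Nat.lt_succ_iff.1 t.2)))) (D.behaviorProb_pos k t).le

/-- Some importance-weighted reward is positive. -/
noncomputable def HasReward : Prop := ∃ (k : Fin D.K) (t : Fin (D.T k + 1)), 0 < D.rtilde k t

lemma hasReward_of_exists
    (hD : ∃ k, ∃ t ≤ D.T k, 0 < D.γ ^ t * (D.reward k t - D.Rmin)) : D.HasReward := by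
  obtain ⟨k, t, ht, h⟩ := hD
  exact ⟨k, ⟨t, Nat.lt_succ_iff.2 ht⟩, div_pos h (D.behaviorProb_pos k t)⟩

/-- `r̃_t^k p(a, z | o, Θ)`. -/
noncomputable def jointWeight (k : Fin D.K) {t : ℕ} (z : JointPath M t) (θ : Param M) : ℝ :=
  D.rtilde k t * ∏ n : Agent M, D.pathWeight k n (θ n) (z n)

lemma sum_jointWeight (k : Fin D.K) (t : ℕ) (θ : Param M) :
    ∑ z : JointPath M t, D.jointWeight k z θ =
      D.rtilde k t * ∏ n : Agent M, D.actWeight k t n (θ n) := by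
  simp only [jointWeight, actWeight]
  rw [← Finset.mul_sum, Finset.prod_univ_sum, Fintype.piFinset_univ]

lemma value_eq (θ : Param M) : D.value θ =
    ∑ k : Fin D.K, ∑ t : Fin (D.T k + 1), ∑ z : JointPath M t, D.jointWeight k z θ / D.K := by
  unfold value
  refine Finset.sum_congr rfl fun k _ => Finset.sum_congr rfl fun t _ => ?_
  rw [← Finset.sum_div, sum_jointWeight]
  ring

variable {D}

lemma HasReward.K_pos (hR : D.HasReward) : (0 : ℝ) < D.K := by
  obtain ⟨k, -⟩ := hR
  exact_mod_cast k.pos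

lemma jointWeight_nonneg {θ : Param M} (hθ : PosParam θ) (k : Fin D.K) (t : Fin (D.T k + 1))
    (z : JointPath M t) : 0 ≤ D.jointWeight k z θ :=
  mul_nonneg (D.rtilde_nonneg k t) (Finset.prod_nonneg fun n _ => pathWeight_nonneg hθ k n (z n))

lemma log_jointWeight {θ : Param M} (hθ : PosParam θ) {k : Fin D.K} {t : ℕ} (ht : 0 < D.rtilde k t)
    {z : JointPath M t} (hz : ∀ n, z n 0 = 0) :
    Real.log (D.jointWeight k z θ) = D.logJoint k z θ := by
  rw [jointWeight, Real.log_mul ht.ne' (Finset.prod_pos fun n _ => pathWeight_pos hθ k n (hz n)).ne',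
    Real.log_prod fun n _ => (pathWeight_pos hθ k n (hz n)).ne', logJoint]
  simp only [log_pathWeight hθ k _ (hz _)]

lemma value_nonneg {θ : Param M} (hθ : PosParam θ) : 0 ≤ D.value θ :=
  Finset.sum_nonneg fun k _ => Finset.sum_nonneg fun t _ => mul_nonneg
    (div_nonneg (D.rtilde_nonneg k t) (Nat.cast_nonneg _))
    (Finset.prod_nonneg fun n _ => (actWeight_pos hθ k n t).le)

lemma HasReward.value_pos (hR : D.HasReward) {θ : Param M} (hθ : PosParam θ) : 0 < D.value θ := by
  have hK := hR.K_pos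
  obtain ⟨k, t, h⟩ := hR
  have hnn : ∀ (k : Fin D.K) (t : Fin (D.T k + 1)), 0 ≤ D.rtilde k t / D.K *
      ∏ n : Agent M, D.actWeight k t n (θ n) := fun k t => mul_nonneg
    (div_nonneg (D.rtilde_nonneg k t) hK.le)
    (Finset.prod_nonneg fun n _ => (actWeight_pos hθ k n t).le)
  exact Finset.sum_pos' (fun k _ => Finset.sum_nonneg fun t _ => hnn k t)
    ⟨k, Finset.mem_univ _, Finset.sum_pos' (fun t _ => hnn k t) ⟨t, Finset.mem_univ _,
      mul_pos (div_pos h hK) (Finset.prod_pos fun n _ => actWeight_pos hθ k n t)⟩⟩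

/-- The action weights in `nuHat` cancel the normalizers of the node probabilities. This exhibits
the update as a Gibbs distribution, with partition function `V̂(D; Θ̃)`. -/
lemma nodeUpdate_eq (h : Hyper M) (k : Fin D.K) (t : Fin (D.T k + 1)) (z : JointPath M t) :
    D.nodeUpdate h k t z = D.jointWeight k z h.tilde / D.value h.tilde := by
  have ha : ∏ n : Agent M, D.actWeight k t n (h.tilde n) ≠ 0 :=
    Finset.prod_ne_zero_iff.2 fun n _ => (actWeight_pos h.posParam_tilde k n t).ne'
  simp only [nodeUpdate, nuHat, jointWeight, nodeProb]
  rw [Finset.prod_div_distrib]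
  field_simp

lemma sum_nodeUpdate (hR : D.HasReward) (h : Hyper M) :
    ∑ k : Fin D.K, ∑ t : Fin (D.T k + 1), ∑ z : JointPath M t, D.nodeUpdate h k t z = D.K := by
  have hK := hR.K_pos
  have hv := hR.value_pos h.posParam_tilde
  have e : ∀ (k : Fin D.K) (t : Fin (D.T k + 1)) (z : JointPath M t), D.nodeUpdate h k t z =
      D.K / D.value h.tilde * (D.jointWeight k z h.tilde / D.K) := fun k t z => by
    rw [nodeUpdate_eq]; field_simp
  simp only [e, ← Finset.mul_sum]
  rw [← value_eq]
  field_simp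

lemma nuHat_nonneg (h : Hyper M) (k : Fin D.K) (t : Fin (D.T k + 1)) :
    0 ≤ D.nuHat h.tilde k t :=
  div_nonneg (mul_nonneg (D.rtilde_nonneg k t)
    (Finset.prod_nonneg fun n _ => (actWeight_pos h.posParam_tilde k n t).le))
    (value_nonneg h.posParam_tilde)

lemma sum_prod_nodeProb (h : Hyper M) (k : Fin D.K) (t : ℕ) :
    ∑ z : JointPath M t, ∏ n : Agent M, D.nodeProb k n (h.tilde n) (z n) = 1 := by
  have e := Finset.prod_univ_sum (fun n : Agent M => (Finset.univ : Finset (Path M n t)))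
    (fun n z => D.nodeProb k n (h.tilde n) z)
  rw [Fintype.piFinset_univ] at e
  rw [← e]
  exact Finset.prod_eq_one fun n _ => sum_nodeProb h.posParam_tilde k n t

lemma sum_nuHat (hR : D.HasReward) (h : Hyper M) :
    ∑ k : Fin D.K, ∑ t : Fin (D.T k + 1), D.nuHat h.tilde k t = D.K := by
  rw [← sum_nodeUpdate hR h]
  refine Finset.sum_congr rfl fun k _ => Finset.sum_congr rfl fun t _ => ?_
  simp only [nodeUpdate]
  rw [← Finset.mul_sum, sum_prod_nodeProb, mul_one]

lemma nuHat_div_le_one (hR : D.HasReward) (h : Hyper M) (k : Fin D.K) (t : Fin (D.T k + 1)) :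
    D.nuHat h.tilde k t / D.K ≤ 1 := by
  rw [div_le_one hR.K_pos, ← sum_nuHat hR h]
  calc D.nuHat h.tilde k t ≤ ∑ t : Fin (D.T k + 1), D.nuHat h.tilde k t :=
        Finset.single_le_sum (f := fun t : Fin (D.T k + 1) => D.nuHat h.tilde k t)
          (fun t _ => nuHat_nonneg h k t) (Finset.mem_univ t)
    _ ≤ _ := Finset.single_le_sum
        (f := fun k => ∑ t : Fin (D.T k + 1), D.nuHat h.tilde k t)
          (fun k _ => Finset.sum_nonneg fun t _ => nuHat_nonneg h k t) (Finset.mem_univ k)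

/-! ### Feasibility -/

lemma FeasibleNodes.nonneg {q : D.NodeWeights} (hq : FeasibleNodes q) (k : Fin D.K)
    (t : Fin (D.T k + 1)) (z : JointPath M t) : 0 ≤ q k t z := by
  obtain ⟨⟨f, hf, h⟩, -⟩ := hq
  rw [h]
  exact Finset.prod_nonneg fun n _ => hf k t n (z n)

lemma FeasibleNodes.sum_div {q : D.NodeWeights} (hq : FeasibleNodes q) (hR : D.HasReward) :
    ∑ k : Fin D.K, ∑ t : Fin (D.T k + 1), ∑ z : JointPath M t, q k t z / D.K = 1 := by
  simp only [← Finset.sum_div]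
  rw [hq.2, div_self hR.K_pos.ne']

lemma feasibleNodes_nodeUpdate (hR : D.HasReward) (h : Hyper M) :
    FeasibleNodes (D.nodeUpdate h) := by
  -- The scalar `ν̂` has to be charged to one agent's factor; this needs an agent to exist.
  let n₀ : Agent M := ⟨0, M.numAgents_pos⟩
  refine ⟨⟨fun k t n z => (if n = n₀ then D.nuHat h.tilde k t else 1) *
    D.nodeProb k n (h.tilde n) z, fun k t n z => mul_nonneg ?_
      (nodeProb_nonneg h.posParam_tilde k n z), fun k t z => ?_⟩, sum_nodeUpdate hR h⟩
  · split_ifs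
    · exact nuHat_nonneg h k t
    · exact zero_le_one
  · rw [Finset.prod_mul_distrib, Finset.prod_ite_eq' Finset.univ n₀, if_pos (Finset.mem_univ _)]
    rfl

lemma _root_.DecSBPR.Hyper.Pos.feasibleParams {h : Hyper M} (hp : h.Pos) :
    FeasibleParams h.law := ⟨h.agentLaw, hp.isProbabilityMeasure_agentLaw, rfl⟩

/-- No logarithm of zero is charged. -/
noncomputable def Supported (q : D.NodeWeights) : Prop :=
  ∀ (k : Fin D.K) (t : Fin (D.T k + 1)) (z : JointPath M t), q k t z ≠ 0 →
    0 < D.rtilde k t ∧ ∀ n, z n 0 = 0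

lemma supported_nodeUpdate (h : Hyper M) : Supported (D.nodeUpdate h) := by
  intro k t z hq
  rw [nodeUpdate_eq] at hq
  have hj : D.jointWeight k z h.tilde ≠ 0 := fun h0 => hq (by rw [h0, zero_div])
  refine ⟨(D.rtilde_nonneg k t).lt_of_ne' (left_ne_zero_of_mul hj), fun n => ?_⟩
  exact eq_zero_of_pathWeight_ne_zero
    (Finset.prod_ne_zero_iff.1 (right_ne_zero_of_mul hj) n (Finset.mem_univ n))

/-! ### Bounds and continuity of the updates -/

lemma xi_nonneg (h : Hyper M) (n : Agent M) (k : Fin D.K) (t : ℕ) (τ : Fin t) (i j : Node M n) :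
    0 ≤ D.xi h n k t τ i j :=
  Finset.sum_nonneg fun z _ => by
    split_ifs
    · exact nodeProb_nonneg h.posParam_tilde k n z
    · exact le_rfl

lemma xi_le_one (h : Hyper M) (n : Agent M) (k : Fin D.K) (t : ℕ) (τ : Fin t) (i j : Node M n) :
    D.xi h n k t τ i j ≤ 1 := by
  rw [← sum_nodeProb h.posParam_tilde k n t]
  refine Finset.sum_le_sum fun z _ => ?_
  split_ifs
  · exact le_rfl
  · exact nodeProb_nonneg h.posParam_tilde k n z

lemma phi_nonneg (h : Hyper M) (n : Agent M) (k : Fin D.K) (t : ℕ) (τ : Fin (t + 1))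
    (i : Node M n) : 0 ≤ D.phi h n k t τ i :=
  Finset.sum_nonneg fun z _ => by
    split_ifs
    · exact nodeProb_nonneg h.posParam_tilde k n z
    · exact le_rfl

lemma phi_le_one (h : Hyper M) (n : Agent M) (k : Fin D.K) (t : ℕ) (τ : Fin (t + 1))
    (i : Node M n) : D.phi h n k t τ i ≤ 1 := by
  rw [← sum_nodeProb h.posParam_tilde k n t]
  refine Finset.sum_le_sum fun z _ => ?_
  split_ifs
  · exact le_rfl
  · exact nodeProb_nonneg h.posParam_tilde k n z

variable (D) in
/-- The reward-weighted action counts. -/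
noncomputable def actCount (h : Hyper M) (n : Agent M) (i : Node M n) (a : Act M n) : ℝ :=
  ∑ k : Fin D.K, ∑ t : Fin (D.T k + 1), ∑ τ : Fin ((t : ℕ) + 1),
    D.nuHat h.tilde k t / D.K * D.phi h n k t τ i * (if D.act k n τ = a then 1 else 0)

lemma zeta_nonneg (h : Hyper M) (n : Agent M) (a : Act M n) (o : Obs M n) (i j : Node M n) :
    0 ≤ D.zeta h n a o i j :=
  Finset.sum_nonneg fun k _ => Finset.sum_nonneg fun t _ => Finset.sum_nonneg fun τ _ =>
    mul_nonneg (mul_nonneg (div_nonneg (nuHat_nonneg h k t) (Nat.cast_nonneg _))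
      (xi_nonneg h n k t τ i j)) (by split_ifs <;> simp)

lemma actCount_nonneg (h : Hyper M) (n : Agent M) (i : Node M n) (a : Act M n) :
    0 ≤ D.actCount h n i a :=
  Finset.sum_nonneg fun k _ => Finset.sum_nonneg fun t _ => Finset.sum_nonneg fun τ _ =>
    mul_nonneg (mul_nonneg (div_nonneg (nuHat_nonneg h k t) (Nat.cast_nonneg _))
      (phi_nonneg h n k t τ i)) (by split_ifs <;> simp)

lemma zeta_le (hR : D.HasReward) (h : Hyper M) (n : Agent M) (a : Act M n) (o : Obs M n)
    (i j : Node M n) : D.zeta h n a o i j ≤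
      ∑ k : Fin D.K, ∑ t : Fin (D.T k + 1), ∑ _τ : Fin (t : ℕ), (1 : ℝ) :=
  Finset.sum_le_sum fun k _ => Finset.sum_le_sum fun t _ => Finset.sum_le_sum fun τ _ =>
    mul_le_one₀ (mul_le_one₀ (nuHat_div_le_one hR h k t) (xi_nonneg h n k t τ i j)
      (xi_le_one h n k t τ i j)) (by split_ifs <;> simp) (by split_ifs <;> simp)

lemma actCount_le (hR : D.HasReward) (h : Hyper M) (n : Agent M) (i : Node M n) (a : Act M n) :
    D.actCount h n i a ≤
      ∑ k : Fin D.K, ∑ t : Fin (D.T k + 1), ∑ _τ : Fin ((t : ℕ) + 1), (1 : ℝ) :=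
  Finset.sum_le_sum fun k _ => Finset.sum_le_sum fun t _ => Finset.sum_le_sum fun τ _ =>
    mul_le_one₀ (mul_le_one₀ (nuHat_div_le_one hR h k t) (phi_nonneg h n k t τ i)
      (phi_le_one h n k t τ i)) (by split_ifs <;> simp) (by split_ifs <;> simp)

lemma vec_le_vec_hyperUpdate (h₀ h : Hyper M) : h₀.vec ≤ (D.hyperUpdate h₀ h).vec := by
  rintro ((x | x) | x)
  · exact le_add_of_nonneg_right (zeta_nonneg h _ _ _ _ _)
  · exact le_add_of_nonneg_right (Finset.sum_nonneg fun l _ => zeta_nonneg h _ _ _ _ _)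
  · exact le_add_of_nonneg_right (actCount_nonneg h _ _ _)

lemma pos_hyperUpdate {h₀ : Hyper M} (hp₀ : h₀.Pos) (h : Hyper M) : (D.hyperUpdate h₀ h).Pos :=
  Hyper.pos_iff_vec.2 fun x => (Hyper.pos_iff_vec.1 hp₀ x).trans_le (vec_le_vec_hyperUpdate h₀ h x)

/-- Every summand of an expected count is at most 1, since `ν̂ / K`, `ξ` and `φ` are. The bound is
uniform in `h`, which puts the updated hyper-parameters in a compact box. -/
lemma exists_vec_hyperUpdate_le (hR : D.HasReward) (h₀ : Hyper M) :
    ∃ B : HyperIx M → ℝ, ∀ h, (D.hyperUpdate h₀ h).vec ≤ B := by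
  let b : ℝ := ∑ k : Fin D.K, ∑ t : Fin (D.T k + 1), ∑ _τ : Fin (t : ℕ), (1 : ℝ)
  refine ⟨Sum.elim (Sum.elim (fun x => h₀.vec (Sum.inl (Sum.inl x)) + b)
    (fun x => h₀.vec (Sum.inl (Sum.inr x)) + ∑ _l ∈ Finset.univ.filter
      (fun l : Node M x.1 => x.2.2.2.2.castSucc < l), b))
    (fun x => h₀.vec (Sum.inr x) + ∑ k : Fin D.K, ∑ t : Fin (D.T k + 1),
      ∑ _τ : Fin ((t : ℕ) + 1), (1 : ℝ)), fun h => ?_⟩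
  rintro ((x | x) | x)
  · exact add_le_add le_rfl (zeta_le hR h _ _ _ _ _)
  · exact add_le_add le_rfl (Finset.sum_le_sum fun l _ => zeta_le hR h _ _ _ _ _)
  · exact add_le_add le_rfl (actCount_le hR h _ _ _)

/-! ### Continuity of the updates as functions of `Θ̃` -/

section Continuity

variable {α : Type*} {l : Filter α} {v : α → Hyper M} {h : Hyper M}

lemma continuous_pathWeight (k : Fin D.K) (n : Agent M) {t : ℕ} (z : Path M n t) :
    Continuous fun θ : Param M => D.pathWeight k n (θ n) z := by
  unfold pathWeight; fun_prop

lemma continuous_actWeight (k : Fin D.K) (t : ℕ) (n : Agent M) :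
    Continuous fun θ : Param M => D.actWeight k t n (θ n) :=
  continuous_finsetSum _ fun z _ => continuous_pathWeight k n z

lemma continuous_value : Continuous D.value := by
  have := fun k t n => continuous_actWeight (D := D) k t n
  unfold value
  fun_prop

lemma tendsto_nodeProb (hl : Tendsto (fun s => (v s).tilde) l (𝓝 h.tilde)) (k : Fin D.K)
    (n : Agent M) {t : ℕ} (z : Path M n t) :
    Tendsto (fun s => D.nodeProb k n ((v s).tilde n) z) l (𝓝 (D.nodeProb k n (h.tilde n) z)) :=
  (((continuous_pathWeight k n z).tendsto _).comp hl).div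
    (((continuous_actWeight k t n).tendsto _).comp hl) (actWeight_pos h.posParam_tilde k n t).ne'

lemma tendsto_nuHat (hR : D.HasReward) (hl : Tendsto (fun s => (v s).tilde) l (𝓝 h.tilde))
    (k : Fin D.K) (t : ℕ) :
    Tendsto (fun s => D.nuHat (v s).tilde k t) l (𝓝 (D.nuHat h.tilde k t)) :=
  ((tendsto_finsetProd _ fun n _ =>
    ((continuous_actWeight k t n).tendsto _).comp hl).const_mul _).div
    ((continuous_value.tendsto _).comp hl) (hR.value_pos h.posParam_tilde).ne'

lemma tendsto_nodeUpdate (hR : D.HasReward) (hl : Tendsto (fun s => (v s).tilde) l (𝓝 h.tilde))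
    (k : Fin D.K) (t : Fin (D.T k + 1)) (z : JointPath M t) :
    Tendsto (fun s => D.nodeUpdate (v s) k t z) l (𝓝 (D.nodeUpdate h k t z)) :=
  (tendsto_nuHat hR hl k t).mul (tendsto_finsetProd _ fun n _ => tendsto_nodeProb hl k n (z n))

lemma tendsto_zeta (hR : D.HasReward) (hl : Tendsto (fun s => (v s).tilde) l (𝓝 h.tilde))
    (n : Agent M) (a : Act M n) (o : Obs M n) (i j : Node M n) :
    Tendsto (fun s => D.zeta (v s) n a o i j) l (𝓝 (D.zeta h n a o i j)) :=
  tendsto_finsetSum _ fun k _ => tendsto_finsetSum _ fun t _ => tendsto_finsetSum _ fun τ _ =>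
    (((tendsto_nuHat hR hl k t).div_const _).mul (tendsto_finsetSum _ fun z _ => by
      split_ifs
      · exact tendsto_nodeProb hl k n z
      · exact tendsto_const_nhds)).mul_const _

lemma tendsto_actCount (hR : D.HasReward) (hl : Tendsto (fun s => (v s).tilde) l (𝓝 h.tilde))
    (n : Agent M) (i : Node M n) (a : Act M n) :
    Tendsto (fun s => D.actCount (v s) n i a) l (𝓝 (D.actCount h n i a)) :=
  tendsto_finsetSum _ fun k _ => tendsto_finsetSum _ fun t _ => tendsto_finsetSum _ fun τ _ =>
    (((tendsto_nuHat hR hl k t).div_const _).mul (tendsto_finsetSum _ fun z _ => by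
      split_ifs
      · exact tendsto_nodeProb hl k n z
      · exact tendsto_const_nhds)).mul_const _

lemma tendsto_vec_hyperUpdate (hR : D.HasReward) (h₀ : Hyper M)
    (hl : Tendsto (fun s => (v s).tilde) l (𝓝 h.tilde)) :
    Tendsto (fun s => (D.hyperUpdate h₀ (v s)).vec) l (𝓝 (D.hyperUpdate h₀ h).vec) := by
  refine tendsto_pi_nhds.2 ?_
  rintro ((x | x) | x)
  · exact (tendsto_zeta hR hl _ _ _ _ _).const_add _
  · exact (tendsto_finsetSum _ fun l _ => tendsto_zeta hR hl _ _ _ _ _).const_add _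
  · exact (tendsto_actCount hR hl _ _ _).const_add _

end Continuity

/-! ### Conjugacy -/

/-- Marginalization of a product distribution: in the term for `m`, all other factors sum to 1. -/
lemma sum_prod_mul_sum {ι : Type*} [Fintype ι] [DecidableEq ι] {Z : ι → Type*}
    [∀ i, Fintype (Z i)] (p f : ∀ i, Z i → ℝ) (hp : ∀ i, ∑ z, p i z = 1) :
    ∑ z : ∀ i, Z i, (∏ i, p i (z i)) * ∑ m, f m (z m) = ∑ m, ∑ z, p m z * f m z := by
  simp only [Finset.mul_sum]
  rw [Finset.sum_comm]
  refine Finset.sum_congr rfl fun m _ => ?_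
  -- Inserting `f` into the factor `m` only lets the product of sums be expanded.
  have e := Finset.prod_univ_sum (fun i : ι => (Finset.univ : Finset (Z i)))
    (fun i z => p i z * if i = m then f i z else 1)
  rw [Fintype.piFinset_univ] at e
  have e1 : ∀ z : ∀ i, Z i, ∏ i, (p i (z i) * if i = m then f i (z i) else 1) =
      (∏ i, p i (z i)) * f m (z m) := fun z => by
    rw [Finset.prod_mul_distrib, Finset.prod_ite_eq' Finset.univ m, if_pos (Finset.mem_univ _)]
  simp only [e1] at e
  rw [← e, Finset.prod_eq_single_of_mem m (Finset.mem_univ m) fun i _ hi => by simp [hi, hp]]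
  simp

/-- The path logarithm depends on single nodes and on consecutive pairs only, so its mean involves
just the marginals `phi` and `xi`. -/
lemma sum_nodeProb_mul_pathLog (h : Hyper M) (θ : Param M) (k : Fin D.K) (n : Agent M) (t : ℕ) :
    ∑ z : Path M n t, D.nodeProb k n (h.tilde n) z * D.pathLog k n (θ n) z =
      ∑ τ : Fin (t + 1), ∑ i, D.phi h n k t τ i * Real.log ((θ n).2 i (D.act k n τ)) +
      ∑ τ : Fin t, ∑ i, ∑ j, D.xi h n k t τ i j *
        Real.log ((θ n).1 (D.act k n τ) (D.obs k n (τ + 1)) i j) := by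
  simp only [pathLog, mul_add, Finset.sum_add_distrib, Finset.mul_sum]
  congr 1
  · rw [Finset.sum_comm]
    refine Finset.sum_congr rfl fun τ _ => ?_
    simp only [phi, Finset.sum_mul]
    rw [Finset.sum_comm]
    refine Finset.sum_congr rfl fun z _ => ?_
    simp [ite_mul]
  · rw [Finset.sum_comm]
    refine Finset.sum_congr rfl fun τ _ => ?_
    simp only [xi, Finset.sum_mul]
    have e : ∀ i, ∑ j, ∑ z : Path M n t, (if z τ.castSucc = i ∧ z τ.succ = j then
          D.nodeProb k n (h.tilde n) z else 0) *
          Real.log ((θ n).1 (D.act k n τ) (D.obs k n (τ + 1)) i j) =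
        ∑ z : Path M n t, ∑ j, (if z τ.castSucc = i ∧ z τ.succ = j then
          D.nodeProb k n (h.tilde n) z else 0) *
          Real.log ((θ n).1 (D.act k n τ) (D.obs k n (τ + 1)) i j) := fun i => Finset.sum_comm
    simp only [e]
    rw [Finset.sum_comm]
    refine Finset.sum_congr rfl fun z _ => ?_
    simp [ite_mul, ite_and]

/-- The length `m t` is `t + 1` for actions and `t` for transitions. -/
lemma sum_steps_comm {X : Type*} [Fintype X] {m : ℕ → ℕ}
    (F : ∀ (k : Fin D.K) (t : Fin (D.T k + 1)), Fin (m t) → X → ℝ) :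
    ∑ k : Fin D.K, ∑ t : Fin (D.T k + 1), ∑ τ : Fin (m t), ∑ x, F k t τ x =
      ∑ x, ∑ k : Fin D.K, ∑ t : Fin (D.T k + 1), ∑ τ : Fin (m t), F k t τ x := by
  symm
  rw [Finset.sum_comm]
  refine Finset.sum_congr rfl fun k _ => ?_
  rw [Finset.sum_comm]
  refine Finset.sum_congr rfl fun t _ => ?_
  rw [Finset.sum_comm]

lemma sum_phi_mul_log (h : Hyper M) (θ : Param M) (n : Agent M) :
    ∑ k : Fin D.K, ∑ t : Fin (D.T k + 1), D.nuHat h.tilde k t / D.K *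
      ∑ τ : Fin ((t : ℕ) + 1), ∑ i, D.phi h n k t τ i * Real.log ((θ n).2 i (D.act k n τ)) =
    ∑ i, ∑ a, D.actCount h n i a * Real.log ((θ n).2 i a) := by
  rw [← Fintype.sum_prod_type' (fun i a => D.actCount h n i a * Real.log ((θ n).2 i a))]
  simp only [actCount, Finset.sum_mul]
  rw [← sum_steps_comm (m := fun t => t + 1)]
  refine Finset.sum_congr rfl fun k _ => Finset.sum_congr rfl fun t _ => ?_
  rw [Finset.mul_sum]
  refine Finset.sum_congr rfl fun τ _ => ?_
  rw [Fintype.sum_prod_type, Finset.mul_sum]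
  refine Finset.sum_congr rfl fun i _ => ?_
  simp [mul_assoc]

lemma sum_xi_mul_log (h : Hyper M) (θ : Param M) (n : Agent M) :
    ∑ k : Fin D.K, ∑ t : Fin (D.T k + 1), D.nuHat h.tilde k t / D.K *
      ∑ τ : Fin (t : ℕ), ∑ i, ∑ j, D.xi h n k t τ i j *
        Real.log ((θ n).1 (D.act k n τ) (D.obs k n (τ + 1)) i j) =
    ∑ a, ∑ o, ∑ i, ∑ j, D.zeta h n a o i j * Real.log ((θ n).1 a o i j) := by
  have e : ∑ a, ∑ o, ∑ i, ∑ j, D.zeta h n a o i j * Real.log ((θ n).1 a o i j) =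
      ∑ x : Act M n × Obs M n × Node M n × Node M n,
        D.zeta h n x.1 x.2.1 x.2.2.1 x.2.2.2 * Real.log ((θ n).1 x.1 x.2.1 x.2.2.1 x.2.2.2) := by
    simp only [Fintype.sum_prod_type]
  rw [e]
  simp only [zeta, Finset.sum_mul]
  rw [← sum_steps_comm (m := fun t => t)]
  refine Finset.sum_congr rfl fun k _ => Finset.sum_congr rfl fun t _ => ?_
  rw [Finset.mul_sum]
  refine Finset.sum_congr rfl fun τ _ => ?_
  simp only [Fintype.sum_prod_type]
  rw [Finset.sum_eq_single_of_mem (D.act k n τ) (Finset.mem_univ _) fun a _ ha => by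
      simp [Ne.symm ha],
    Finset.sum_eq_single_of_mem (D.obs k n (τ + 1)) (Finset.mem_univ _) fun o _ ho => by
      simp [Ne.symm ho]]
  simp [Finset.mul_sum, mul_assoc]

/-- Conjugacy of stick-breaking rows: `ln V_l` occurs only in the weight `l` and `ln (1 - V_l)` in
all later ones, so their coefficients are `ζ^l` and the tail sum of `ζ`. These are the increments of
`σ` and `η`. -/
lemma sum_zeta_mul_log {θ : Param M} (hθ : Regular θ) (h₀ h : Hyper M) (n : Agent M) (a : Act M n)
    (o : Obs M n) (i : Node M n) : ∑ j, D.zeta h n a o i j * Real.log ((θ n).1 a o i j) =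
      ∑ l, (((D.hyperUpdate h₀ h).σ n a o i l - h₀.σ n a o i l) *
          Real.log (stick ((θ n).1 a o i) l) +
        ((D.hyperUpdate h₀ h).η n a o i l - h₀.η n a o i l) *
          Real.log (1 - stick ((θ n).1 a o i) l)) := by
  simp only [hθ.log_trans n a o i, Finset.mul_sum]
  rw [Finset.sum_comm]
  refine Finset.sum_congr rfl fun l _ => ?_
  simp only [hyperUpdate, add_sub_cancel_left, mul_add, Finset.sum_add_distrib, Finset.sum_mul,
    Finset.sum_filter]
  congr 1
  · simp
  · exact Finset.sum_congr rfl fun j _ => by split_ifs <;> simp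

/-- The node posteriors enter the lower bound as a log density ratio of the updated law. -/
lemma sum_nodeUpdate_mul_logJoint {θ : Param M} (hθ : Regular θ) (h₀ h : Hyper M) :
    ∑ k : Fin D.K, ∑ t : Fin (D.T k + 1), ∑ z : JointPath M t,
        D.nodeUpdate h k t z / D.K * D.logJoint k z θ =
      ∑ k : Fin D.K, ∑ t : Fin (D.T k + 1), ∑ z : JointPath M t,
        D.nodeUpdate h k t z / D.K * Real.log (D.rtilde k t) +
      score logStat h₀.vec (D.hyperUpdate h₀ h).vec θ := by
  simp only [logJoint, mul_add, Finset.sum_add_distrib]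
  congr 1
  have e1 : ∀ (k : Fin D.K) (t : Fin (D.T k + 1)), ∑ z : JointPath M t,
      D.nodeUpdate h k t z / D.K * ∑ n, D.pathLog k n (θ n) (z n) =
      ∑ n, D.nuHat h.tilde k t / D.K *
        ∑ z : Path M n t, D.nodeProb k n (h.tilde n) z * D.pathLog k n (θ n) z := by
    intro k t
    rw [← Finset.mul_sum, ← sum_prod_mul_sum (fun n (z : Path M n t) => D.nodeProb k n (h.tilde n) z)
      (fun n z => D.pathLog k n (θ n) z) fun n => sum_nodeProb h.posParam_tilde k n t,
      Finset.mul_sum]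
    refine Finset.sum_congr rfl fun z _ => ?_
    simp only [nodeUpdate]
    ring
  simp only [e1, sum_nodeProb_mul_pathLog]
  have e2 : ∀ F : ∀ (k : Fin D.K) (_ : Fin (D.T k + 1)), Agent M → ℝ,
      ∑ k : Fin D.K, ∑ t : Fin (D.T k + 1), ∑ n, F k t n =
        ∑ n, ∑ k : Fin D.K, ∑ t : Fin (D.T k + 1), F k t n := fun F => by
    symm
    rw [Finset.sum_comm]
    exact Finset.sum_congr rfl fun k _ => Finset.sum_comm
  rw [e2, score_logStat]
  refine Finset.sum_congr rfl fun n _ => ?_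
  simp only [mul_add, Finset.sum_add_distrib]
  rw [sum_phi_mul_log, sum_xi_mul_log, add_comm]
  congr 1
  · simp only [sum_zeta_mul_log hθ h₀, Finset.sum_add_distrib]
  · simp only [hyperUpdate, add_sub_cancel_left]
    rfl

/-! ### The lower bound -/

lemma integrable_pathLog {h : Hyper M} (hp : h.Pos) (k : Fin D.K) (n : Agent M) {t : ℕ}
    (z : Path M n t) : Integrable (fun θ : Param M => D.pathLog k n (θ n) z) h.law :=
  (integrable_finsetSum _ fun _ _ => hp.integrable_log_emis _ _ _).add
    (integrable_finsetSum _ fun _ _ => hp.integrable_log_trans _ _ _ _ _)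

/-- The purpose of `Θ̃`: its logarithms are the mean logarithms, and the path logarithm is linear in
logarithms. -/
lemma integral_pathLog {h : Hyper M} (hp : h.Pos) (k : Fin D.K) (n : Agent M) {t : ℕ}
    (z : Path M n t) : ∫ θ : Param M, D.pathLog k n (θ n) z ∂h.law =
      D.pathLog k n (h.tilde n) z := by
  unfold pathLog
  rw [integral_add (integrable_finsetSum _ fun _ _ => hp.integrable_log_emis _ _ _)
    (integrable_finsetSum _ fun _ _ => hp.integrable_log_trans _ _ _ _ _),
    integral_finsetSum _ fun _ _ => hp.integrable_log_emis _ _ _,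
    integral_finsetSum _ fun _ _ => hp.integrable_log_trans _ _ _ _ _]
  simp only [hp.tilde_emis, hp.tilde_trans, Real.log_exp]

lemma integrable_logJoint {h : Hyper M} (hp : h.Pos) (k : Fin D.K) {t : ℕ} (z : JointPath M t) :
    Integrable (D.logJoint k z) h.law := by
  have := hp.isProbabilityMeasure_law
  exact (integrable_const _).add (integrable_finsetSum _ fun n _ => integrable_pathLog hp k n (z n))

lemma integral_logJoint {h : Hyper M} (hp : h.Pos) (k : Fin D.K) {t : ℕ} (z : JointPath M t) :
    ∫ θ, D.logJoint k z θ ∂h.law = D.logJoint k z h.tilde := by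
  have := hp.isProbabilityMeasure_law
  unfold logJoint
  rw [integral_add (integrable_const _)
    (integrable_finsetSum _ fun n _ => integrable_pathLog hp k n (z n)),
    integral_finsetSum _ fun n _ => integrable_pathLog hp k n (z n)]
  simp [integral_pathLog hp]

lemma ae_rnDeriv_toReal_pos {X : Type*} [MeasurableSpace X] {P Q : Measure X}
    [IsProbabilityMeasure P] [IsProbabilityMeasure Q] (hQP : Q ≪ P) :
    ∀ᵐ x ∂Q, 0 < (Q.rnDeriv P x).toReal := by
  filter_upwards [Measure.rnDeriv_pos hQP, hQP.ae_le (Q.rnDeriv_lt_top P)] with x h0 h1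
  exact ENNReal.toReal_pos h0.ne' h1.ne

lemma LBFinite.supported {P Q : Measure (Param M)} [IsProbabilityMeasure Q] {q : D.NodeWeights}
    (H : D.LBFinite P q Q) : Supported q := by
  intro k t z hq
  obtain ⟨θ, hθ⟩ := ((H.2 k t z hq).1).exists
  have hne := hθ.ne'
  exact ⟨(D.rtilde_nonneg k t).lt_of_ne' (left_ne_zero_of_mul hne), fun n =>
    eq_zero_of_pathWeight_ne_zero
      (Finset.prod_ne_zero_iff.1 (right_ne_zero_of_mul hne) n (Finset.mem_univ n))⟩

/-- Paths with `q = 0` need no care, as both sides carry the factor `q`; on the others the support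
condition makes every logarithm split. -/
lemma lbIntegrand_eq {P Q : Measure (Param M)} {q : D.NodeWeights} (hq : Supported q)
    {θ : Param M} (hθ : Regular θ) (hr : 0 < (Q.rnDeriv P θ).toReal) (k : Fin D.K)
    (t : Fin (D.T k + 1)) (z : JointPath M t) : D.lbIntegrand P q Q k t z θ =
      q k t z / D.K * (D.logJoint k z θ - Real.log (q k t z) -
        Real.log (Q.rnDeriv P θ).toReal) := by
  unfold lbIntegrand
  rcases eq_or_ne (q k t z) 0 with h0 | h0
  · rw [h0, zero_div, zero_mul, zero_mul]
  · obtain ⟨ht, hz⟩ := hq k t z h0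
    have hj : 0 < D.jointWeight k z θ :=
      mul_pos ht (Finset.prod_pos fun n _ => pathWeight_pos hθ.posParam k n (hz n))
    rw [← log_jointWeight hθ.posParam ht hz]
    change _ * Real.log (D.jointWeight k z θ / _) = _
    rw [Real.log_div hj.ne' (mul_ne_zero h0 hr.ne'), Real.log_mul h0 hr.ne']
    ring

/-- The sum of the integrands. -/
noncomputable def lbTotal (P : Measure (Param M)) (q : D.NodeWeights) (Q : Measure (Param M))
    (θ : Param M) : ℝ :=
  ∑ k : Fin D.K, ∑ t : Fin (D.T k + 1), ∑ z : JointPath M t, D.lbIntegrand P q Q k t z θ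

/-- The entropy of the node posteriors. -/
noncomputable def nodeEntropy (q : D.NodeWeights) : ℝ :=
  -∑ k : Fin D.K, ∑ t : Fin (D.T k + 1), ∑ z : JointPath M t, q k t z / D.K * Real.log (q k t z)

lemma LBFinite.integrable {P Q : Measure (Param M)} {q : D.NodeWeights} (H : D.LBFinite P q Q)
    (k : Fin D.K) (t : Fin (D.T k + 1)) (z : JointPath M t) :
    Integrable (D.lbIntegrand P q Q k t z) Q := by
  rcases eq_or_ne (q k t z) 0 with h0 | h0
  · have : D.lbIntegrand P q Q k t z = fun _ => 0 := by funext θ; simp [lbIntegrand, h0]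
    rw [this]
    exact integrable_zero _ _ _
  · exact (H.2 k t z h0).2

lemma LBFinite.integrable_lbTotal {P Q : Measure (Param M)} {q : D.NodeWeights}
    (H : D.LBFinite P q Q) : Integrable (lbTotal P q Q) Q :=
  integrable_finsetSum _ fun k _ => integrable_finsetSum _ fun t _ =>
    integrable_finsetSum _ fun z _ => H.integrable k t z

lemma LBFinite.LB_eq {P Q : Measure (Param M)} {q : D.NodeWeights} (H : D.LBFinite P q Q) :
    D.LB P q Q = ((∫ θ, lbTotal P q Q θ ∂Q : ℝ) : EReal) := by
  rw [LB, if_pos H]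
  congr 1
  unfold lbTotal
  rw [integral_finsetSum _ fun k _ => integrable_finsetSum _ fun t _ =>
    integrable_finsetSum _ fun z _ => H.integrable k t z]
  refine Finset.sum_congr rfl fun k _ => ?_
  rw [integral_finsetSum _ fun t _ => integrable_finsetSum _ fun z _ => H.integrable k t z]
  refine Finset.sum_congr rfl fun t _ => ?_
  rw [integral_finsetSum _ fun z _ => H.integrable k t z]

/-- Because the weights `q / K` sum to 1, the log density of `Q` is counted exactly once. -/
lemma lbTotal_eq (hR : D.HasReward) {P Q : Measure (Param M)} {q : D.NodeWeights}
    (hqf : FeasibleNodes q) (hq : Supported q)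
    {θ : Param M} (hθ : Regular θ) (hr : 0 < (Q.rnDeriv P θ).toReal) : lbTotal P q Q θ =
      ∑ k : Fin D.K, ∑ t : Fin (D.T k + 1), ∑ z : JointPath M t, q k t z / D.K * D.logJoint k z θ
        + nodeEntropy q - Real.log (Q.rnDeriv P θ).toReal := by
  have h1 : Real.log (Q.rnDeriv P θ).toReal = ∑ k : Fin D.K, ∑ t : Fin (D.T k + 1),
      ∑ z : JointPath M t, q k t z / D.K * Real.log (Q.rnDeriv P θ).toReal := by
    simp only [← Finset.sum_mul]
    rw [hqf.sum_div hR, one_mul]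
  rw [h1]
  simp only [lbTotal, nodeEntropy, lbIntegrand_eq hq hθ hr, mul_sub, Finset.sum_sub_distrib]
  ring

lemma law_absolutelyContinuous {h₀ h : Hyper M} (hp₀ : h₀.Pos) (hp : h.Pos) :
    h.law ≪ h₀.law := by
  rw [Hyper.law_eq_tilted hp₀ hp]; exact tilted_absolutelyContinuous _ _

lemma ae_log_rnDeriv_law {h₀ h : Hyper M} (hp₀ : h₀.Pos) (hp : h.Pos) :
    ∀ᵐ θ ∂h.law, Real.log (h.law.rnDeriv h₀.law θ).toReal = score logStat h₀.vec h.vec θ -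
      Real.log (∫ θ, Real.exp (score logStat h₀.vec h.vec θ) ∂h₀.law) := by
  have := hp₀.isProbabilityMeasure_law
  have hE := hp₀.isExpFamily.integrable h.vec (Hyper.pos_iff_vec.1 hp)
  refine (law_absolutelyContinuous hp₀ hp).ae_le ?_
  have e := log_rnDeriv_tilted_left_self hE
  rw [← Hyper.law_eq_tilted hp₀ hp] at e
  exact e

lemma integrable_score_law {h₀ h : Hyper M} (hp₀ : h₀.Pos) (hp : h.Pos) (c : HyperIx M → ℝ) :
    Integrable (score logStat h₀.vec c) h.law := by
  rw [Hyper.law_eq_tilted hp₀ hp]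
  exact hp₀.isExpFamily.integrable_score (Hyper.pos_iff_vec.1 hp) c

lemma lbFinite_law {h₀ h : Hyper M} (hp₀ : h₀.Pos) (hp : h.Pos) {q : D.NodeWeights}
    (hq : Supported q) : D.LBFinite h₀.law q h.law := by
  have := hp₀.isProbabilityMeasure_law
  have := hp.isProbabilityMeasure_law
  have hac := law_absolutelyContinuous hp₀ hp
  refine ⟨hac, fun k t z h0 => ⟨?_, ?_⟩⟩
  · filter_upwards [hp.ae_regular] with θ hθ
    exact mul_pos (hq k t z h0).1
      (Finset.prod_pos fun n _ => pathWeight_pos hθ.posParam k n ((hq k t z h0).2 n))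
  · refine ((((integrable_logJoint hp k z).sub (integrable_const (Real.log (q k t z)))).sub
      ((integrable_score_law hp₀ hp h.vec).sub (integrable_const
        (Real.log (∫ θ, Real.exp (score logStat h₀.vec h.vec θ) ∂h₀.law))))).const_mul
          (q k t z / D.K)).congr ?_
    filter_upwards [hp.ae_regular, ae_rnDeriv_toReal_pos hac, ae_log_rnDeriv_law hp₀ hp]
      with θ hθ hr he
    rw [lbIntegrand_eq hq hθ hr, he]
    rfl

lemma LB_law (hR : D.HasReward) {h₀ h : Hyper M} (hp₀ : h₀.Pos) (hp : h.Pos) {q : D.NodeWeights}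
    (hqf : FeasibleNodes q) (hq : Supported q) : D.LB h₀.law q h.law =
      ((∑ k : Fin D.K, ∑ t : Fin (D.T k + 1), ∑ z : JointPath M t,
        q k t z / D.K * D.logJoint k z h.tilde + nodeEntropy q - Hyper.relEntropy h₀ h : ℝ) :
          EReal) := by
  have := hp₀.isProbabilityMeasure_law
  have := hp.isProbabilityMeasure_law
  rw [(lbFinite_law hp₀ hp hq).LB_eq]
  congr 1
  have hi : Integrable (fun θ => ∑ k : Fin D.K, ∑ t : Fin (D.T k + 1), ∑ z : JointPath M t,
      q k t z / D.K * D.logJoint k z θ) h.law :=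
    integrable_finsetSum _ fun k _ => integrable_finsetSum _ fun t _ =>
      integrable_finsetSum _ fun z _ => (integrable_logJoint hp k z).const_mul _
  have hs := integrable_score_law hp₀ hp h.vec
  have e : ∀ᵐ θ ∂h.law, lbTotal h₀.law q h.law θ = (∑ k : Fin D.K, ∑ t : Fin (D.T k + 1),
      ∑ z : JointPath M t, q k t z / D.K * D.logJoint k z θ + nodeEntropy q) -
        (score logStat h₀.vec h.vec θ -
          Real.log (∫ θ, Real.exp (score logStat h₀.vec h.vec θ) ∂h₀.law)) := by
    filter_upwards [hp.ae_regular, ae_rnDeriv_toReal_pos (law_absolutelyContinuous hp₀ hp),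
      ae_log_rnDeriv_law hp₀ hp] with θ hθ hr he
    rw [lbTotal_eq hR hqf hq hθ hr, he]
  have ha : Integrable (fun θ => ∑ k : Fin D.K, ∑ t : Fin (D.T k + 1), ∑ z : JointPath M t,
      q k t z / D.K * D.logJoint k z θ + nodeEntropy q) h.law := hi.add (integrable_const _)
  have hb : Integrable (fun θ => score logStat h₀.vec h.vec θ -
      Real.log (∫ θ, Real.exp (score logStat h₀.vec h.vec θ) ∂h₀.law)) h.law :=
    hs.sub (integrable_const _)
  rw [integral_congr_ae e, integral_sub ha hb, integral_add hi (integrable_const _),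
    integral_sub hs (integrable_const _), integral_const, integral_const, Hyper.relEntropy]
  simp only [probReal_univ, one_smul]
  congr 2
  rw [integral_finsetSum _ fun k _ => integrable_finsetSum _ fun t _ =>
      integrable_finsetSum _ fun z _ => (integrable_logJoint hp k z).const_mul _]
  refine Finset.sum_congr rfl fun k _ => ?_
  rw [integral_finsetSum _ fun t _ => integrable_finsetSum _ fun z _ =>
    (integrable_logJoint hp k z).const_mul _]
  refine Finset.sum_congr rfl fun t _ => ?_
  rw [integral_finsetSum _ fun z _ => (integrable_logJoint hp k z).const_mul _]
  exact Finset.sum_congr rfl fun z _ => by rw [integral_const_mul, integral_logJoint hp]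

/-! ### Optimality of the two updates -/

lemma FeasibleParams.isProbabilityMeasure {Q : Measure (Param M)} (hQ : FeasibleParams Q) :
    IsProbabilityMeasure Q := by
  obtain ⟨R, hR, rfl⟩ := hQ
  infer_instance

variable (D) in
/-- The lower bound at hyper-parameters `h` and the node posteriors computed from them. -/
noncomputable def bound (h₀ h : Hyper M) : ℝ := Real.log (D.value h.tilde) - Hyper.relEntropy h₀ h

/-- Equality case of Gibbs: wherever the updated `q` is nonzero, log joint weight minus `ln q` is
the constant `ln V̂(D; Θ̃)`. -/
lemma LB_nodeUpdate (hR : D.HasReward) {h₀ h : Hyper M} (hp₀ : h₀.Pos) (hp : h.Pos) :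
    D.LB h₀.law (D.nodeUpdate h) h.law = (D.bound h₀ h : EReal) := by
  have hqf := feasibleNodes_nodeUpdate hR h
  have hq := supported_nodeUpdate (D := D) h
  have hv := hR.value_pos h.posParam_tilde
  rw [LB_law hR hp₀ hp hqf hq, bound]
  congr 2
  have e : ∀ (k : Fin D.K) (t : Fin (D.T k + 1)) (z : JointPath M t),
      D.nodeUpdate h k t z / D.K * D.logJoint k z h.tilde -
        D.nodeUpdate h k t z / D.K * Real.log (D.nodeUpdate h k t z) =
      D.nodeUpdate h k t z / D.K * Real.log (D.value h.tilde) := by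
    intro k t z
    rcases eq_or_ne (D.nodeUpdate h k t z) 0 with h0 | h0
    · simp [h0]
    · obtain ⟨ht, hz⟩ := hq k t z h0
      have hj : D.jointWeight k z h.tilde ≠ 0 := fun hj => h0 (by rw [nodeUpdate_eq, hj, zero_div])
      rw [← log_jointWeight h.posParam_tilde ht hz, ← mul_sub]
      congr 1
      rw [nodeUpdate_eq, Real.log_div hj hv.ne']
      ring
  rw [nodeEntropy, ← sub_eq_add_neg]
  simp only [← Finset.sum_sub_distrib, e, ← Finset.sum_mul]
  rw [hqf.sum_div hR, one_mul]

/-- Finite Gibbs inequality; of feasibility only nonnegativity and total mass enter. -/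
lemma LB_le_bound (hR : D.HasReward) {h₀ h : Hyper M} (hp₀ : h₀.Pos) (hp : h.Pos)
    {q : D.NodeWeights} (hqf : FeasibleNodes q) :
    D.LB h₀.law q h.law ≤ (D.bound h₀ h : EReal) := by
  have := hp.isProbabilityMeasure_law
  by_cases H : D.LBFinite h₀.law q h.law
  · have hq := H.supported
    have hK := hR.K_pos
    have hv := hR.value_pos h.posParam_tilde
    rw [LB_law hR hp₀ hp hqf hq, bound]
    refine EReal.coe_le_coe_iff.2 (sub_le_sub_right ?_ _)
    -- `ln x ≤ x - 1` at `x = J / (q V̂)`, with `J` the joint weight and `V̂` the value at `Θ̃`,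
    -- times `q / K`. On summation the right side becomes `ln V̂ - 1 + 1`.
    have e : ∀ (k : Fin D.K) (t : Fin (D.T k + 1)) (z : JointPath M t),
        q k t z / D.K * D.logJoint k z h.tilde - q k t z / D.K * Real.log (q k t z) ≤
          q k t z / D.K * (Real.log (D.value h.tilde) - 1) +
            D.jointWeight k z h.tilde / D.K * (D.value h.tilde)⁻¹ := by
      intro k t z
      have hj0 := jointWeight_nonneg h.posParam_tilde k t z
      rcases eq_or_ne (q k t z) 0 with h0 | h0
      · rw [h0]
        simp only [zero_div, zero_mul, sub_zero, zero_add]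
        positivity
      · obtain ⟨ht, hz⟩ := hq k t z h0
        have hq0 : 0 < q k t z := (hqf.nonneg k t z).lt_of_ne' h0
        have hj : 0 < D.jointWeight k z h.tilde :=
          mul_pos ht (Finset.prod_pos fun n _ => pathWeight_pos h.posParam_tilde k n (hz n))
        rw [← log_jointWeight h.posParam_tilde ht hz, ← mul_sub]
        have hl := Real.log_le_sub_one_of_pos
          (div_pos hj (mul_pos hq0 hv))
        rw [Real.log_div hj.ne' (mul_pos hq0 hv).ne', Real.log_mul hq0.ne' hv.ne'] at hl
        have hm := mul_le_mul_of_nonneg_left hl (div_nonneg hq0.le hK.le)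
        have e1 : q k t z / D.K * (D.jointWeight k z h.tilde / (q k t z * D.value h.tilde) - 1) =
            D.jointWeight k z h.tilde / D.K * (D.value h.tilde)⁻¹ - q k t z / D.K := by
          field_simp
        rw [e1] at hm
        linarith
    have es := Finset.sum_le_sum fun k (_ : k ∈ Finset.univ) => Finset.sum_le_sum
      fun t (_ : t ∈ Finset.univ) => Finset.sum_le_sum fun z (_ : z ∈ Finset.univ) => e k t z
    simp only [Finset.sum_add_distrib, Finset.sum_sub_distrib, ← Finset.sum_mul] at es
    rw [hqf.sum_div hR, ← value_eq, mul_inv_cancel₀ hv.ne'] at es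
    rw [nodeEntropy]
    linarith
  · rw [LB, if_neg H]
    exact bot_le

/-- Gibbs' inequality for the lower bound. -/
lemma LB_le_of_le {P Q : Measure (Param M)} [IsProbabilityMeasure P] [IsProbabilityMeasure Q]
    {q : D.NodeWeights} {c : ℝ} {g : Param M → ℝ} (hg : Measurable g) (hg0 : ∀ᵐ θ ∂P, 0 ≤ g θ)
    (hgP : Integrable g P) (hg1 : ∫ θ, g θ ∂P ≤ 1)
    (hfg : D.LBFinite P q Q →
      ∀ᵐ θ ∂Q, lbTotal P q Q θ - c ≤ g θ / (Q.rnDeriv P θ).toReal - 1) :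
    D.LB P q Q ≤ (c : EReal) := by
  by_cases H : D.LBFinite P q Q
  · rw [H.LB_eq]
    refine EReal.coe_le_coe_iff.2 ?_
    have hi := H.integrable_lbTotal
    have := integral_nonpos_of_le_div_rnDeriv_sub_one H.1 hg hg0 hgP hg1
      (hi.sub (integrable_const c)) (hfg H)
    rw [integral_sub' hi (integrable_const c)] at this
    simpa using this
  · rw [LB, if_neg H]
    exact bot_le

/-- For these node posteriors the bound is a constant plus the `Q`-mean of score minus log density.
Gibbs' inequality makes the prior tilted by the score optimal among all probability laws. -/
lemma LB_le_LB_hyperUpdate (hR : D.HasReward) {h₀ : Hyper M} (hp₀ : h₀.Pos) (h : Hyper M)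
    {Q : Measure (Param M)} (hQ : FeasibleParams Q) :
    D.LB h₀.law (D.nodeUpdate h) Q ≤
      D.LB h₀.law (D.nodeUpdate h) (D.hyperUpdate h₀ h).law := by
  have := hp₀.isProbabilityMeasure_law
  have := hQ.isProbabilityMeasure
  have hp := pos_hyperUpdate (D := D) hp₀ h
  have := hp.isProbabilityMeasure_law
  have hqf := feasibleNodes_nodeUpdate hR h
  have hq := supported_nodeUpdate (D := D) h
  set h' := D.hyperUpdate h₀ h with hh'
  have hs := integrable_score_law hp₀ hp h'.vec
  have hE := hp₀.isExpFamily.integrable h'.vec (Hyper.pos_iff_vec.1 hp)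
  have hZ : 0 < ∫ θ, Real.exp (score logStat h₀.vec h'.vec θ) ∂h₀.law := integral_exp_pos hE
  set Z := ∫ θ, Real.exp (score logStat h₀.vec h'.vec θ) ∂h₀.law with hZdef
  set C := ∑ k : Fin D.K, ∑ t : Fin (D.T k + 1), ∑ z : JointPath M t,
    D.nodeUpdate h k t z / D.K * Real.log (D.rtilde k t) with hC
  -- At the updated law the score cancels against the log density and the integrand is almost
  -- everywhere constant.
  have hc : D.LB h₀.law (D.nodeUpdate h) h'.law =
      ((C + nodeEntropy (D.nodeUpdate h) + Real.log Z : ℝ) : EReal) := by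
    rw [(lbFinite_law hp₀ hp hq).LB_eq]
    congr 1
    have e : ∀ᵐ θ ∂h'.law, lbTotal h₀.law (D.nodeUpdate h) h'.law θ =
        C + nodeEntropy (D.nodeUpdate h) + Real.log Z := by
      filter_upwards [hp.ae_regular, ae_rnDeriv_toReal_pos (law_absolutelyContinuous hp₀ hp),
        ae_log_rnDeriv_law hp₀ hp] with θ hθ hr he
      rw [lbTotal_eq hR hqf hq hθ hr, he, sum_nodeUpdate_mul_logJoint hθ h₀ h]
      ring
    rw [integral_congr_ae e]
    simp
  rw [hc]
  have hsm := hp₀.isExpFamily.measurable_score h'.vec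
  -- The function `g` is the density of the updated law with respect to the prior.
  refine LB_le_of_le (g := fun θ => Real.exp (score logStat h₀.vec h'.vec θ) / Z) (by fun_prop)
    (Eventually.of_forall fun θ => by positivity) (hE.div_const Z) ?_ fun H => ?_
  · rw [integral_div, ← hZdef, div_self hZ.ne']
  · filter_upwards [H.1.ae_le hp₀.ae_regular, ae_rnDeriv_toReal_pos H.1] with θ hθ hr
    rw [lbTotal_eq hR hqf hq hθ hr, sum_nodeUpdate_mul_logJoint hθ h₀ h]
    have hl := Real.log_le_sub_one_of_pos
      (div_pos (div_pos (Real.exp_pos (score logStat h₀.vec h'.vec θ)) hZ) hr)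
    rw [Real.log_div (by positivity) hr.ne', Real.log_div (Real.exp_ne_zero _) hZ.ne',
      Real.log_exp] at hl
    linarith

/-! ### The marginal value bounds the lower bound -/

lemma integrable_value {h₀ : Hyper M} (hp₀ : h₀.Pos) : Integrable D.value h₀.law := by
  have := hp₀.isProbabilityMeasure_law
  have hm : ∀ (k : Fin D.K) (n : Agent M) {t : ℕ} (z : Path M n t),
      Measurable fun θ : Param M => D.pathWeight k n (θ n) z := fun k n t z => by
    unfold pathWeight; fun_prop
  rw [funext D.value_eq]
  refine integrable_finsetSum _ fun k _ => integrable_finsetSum _ fun t _ =>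
    integrable_finsetSum _ fun z _ => Integrable.div_const ?_ _
  have hm' : Measurable (D.jointWeight k z) := by
    have := fun n => hm k n (z n)
    unfold jointWeight
    fun_prop
  refine Integrable.of_bound hm'.aestronglyMeasurable (D.rtilde k t) ?_
  filter_upwards [hp₀.ae_regular] with θ hθ
  rw [Real.norm_eq_abs, abs_of_nonneg (jointWeight_nonneg hθ.posParam k t z)]
  exact mul_le_of_le_one_right (D.rtilde_nonneg k t)
    (Finset.prod_le_one (fun n _ => pathWeight_nonneg hθ.posParam k n (z n))
      fun n _ => pathWeight_le_one hθ k n (z n))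

lemma marginalValue_pos (hR : D.HasReward) {h₀ : Hyper M} (hp₀ : h₀.Pos) :
    0 < D.marginalValue h₀.law := by
  have := hp₀.isProbabilityMeasure_law
  have h0 : 0 ≤ᵐ[h₀.law] D.value := by
    filter_upwards [hp₀.ae_regular] with θ hθ using value_nonneg hθ.posParam
  refine (integral_nonneg_of_ae h0).lt_of_ne fun he => ?_
  have h1 := (integral_eq_zero_iff_of_nonneg_ae h0 (integrable_value hp₀)).1 he.symm
  obtain ⟨θ, hθ, h2⟩ := (hp₀.ae_regular.and h1).exists
  exact (hR.value_pos hθ.posParam).ne' h2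

/-- Jensen's inequality in Gibbs form, against the law with prior density `V̂(D; Θ) / V̂(D)`. -/
lemma LB_le_log_marginalValue (hR : D.HasReward) {h₀ : Hyper M} (hp₀ : h₀.Pos)
    {q : D.NodeWeights} {Q : Measure (Param M)} (hqf : FeasibleNodes q) (hQ : FeasibleParams Q) :
    D.LB h₀.law q Q ≤ (Real.log (D.marginalValue h₀.law) : EReal) := by
  have := hp₀.isProbabilityMeasure_law
  have := hQ.isProbabilityMeasure
  have hm := marginalValue_pos hR hp₀
  have hK := hR.K_pos
  refine LB_le_of_le (g := fun θ => D.value θ / D.marginalValue h₀.law) ?_ ?_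
    ((integrable_value hp₀).div_const _) ?_ fun H => ?_
  · have hv : Measurable D.value := by
      unfold value actWeight pathWeight; fun_prop
    fun_prop
  · filter_upwards [hp₀.ae_regular] with θ hθ using div_nonneg (value_nonneg hθ.posParam) hm.le
  · rw [integral_div]
    exact (div_self hm.ne').le
  · have hq := H.supported
    filter_upwards [H.1.ae_le hp₀.ae_regular, ae_rnDeriv_toReal_pos H.1] with θ hθ hr
    set m := D.marginalValue h₀.law
    set ρ := (Q.rnDeriv h₀.law θ).toReal with hρ
    -- `ln x ≤ x - 1` at `x = J / (q m ρ)`. Summing, the weights `q / K` give 1 and the terms `J /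
    -- K` give `V̂(D; Θ)`.
    have e : ∀ (k : Fin D.K) (t : Fin (D.T k + 1)) (z : JointPath M t),
        D.lbIntegrand h₀.law q Q k t z θ ≤
          q k t z / D.K * (Real.log m - 1) + D.jointWeight k z θ / D.K * (m * ρ)⁻¹ := by
      intro k t z
      have hj0 := jointWeight_nonneg hθ.posParam k t z
      rw [lbIntegrand_eq hq hθ hr, ← hρ]
      rcases eq_or_ne (q k t z) 0 with h0 | h0
      · rw [h0]
        simp only [zero_div, zero_mul, zero_add]
        positivity
      · obtain ⟨ht, hz⟩ := hq k t z h0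
        have hq0 : 0 < q k t z := (hqf.nonneg k t z).lt_of_ne' h0
        have hj : 0 < D.jointWeight k z θ :=
          mul_pos ht (Finset.prod_pos fun n _ => pathWeight_pos hθ.posParam k n (hz n))
        rw [← log_jointWeight hθ.posParam ht hz]
        have hmr := mul_pos hm hr
        have hl := Real.log_le_sub_one_of_pos (div_pos hj (mul_pos hq0 hmr))
        rw [Real.log_div hj.ne' (mul_pos hq0 hmr).ne', Real.log_mul hq0.ne' hmr.ne',
          Real.log_mul hm.ne' hr.ne'] at hl
        have hmul := mul_le_mul_of_nonneg_left hl (div_nonneg hq0.le hK.le)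
        have e1 : q k t z / D.K * (D.jointWeight k z θ / (q k t z * (m * ρ)) - 1) =
            D.jointWeight k z θ / D.K * (m * ρ)⁻¹ - q k t z / D.K := by
          field_simp
        rw [e1] at hmul
        linarith
    have es := Finset.sum_le_sum fun k (_ : k ∈ Finset.univ) => Finset.sum_le_sum
      fun t (_ : t ∈ Finset.univ) => Finset.sum_le_sum fun z (_ : z ∈ Finset.univ) => e k t z
    simp only [Finset.sum_add_distrib, ← Finset.sum_mul] at es
    rw [hqf.sum_div hR, ← value_eq] at es
    have e2 : D.value θ / m / ρ = D.value θ * (m * ρ)⁻¹ := by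
      rw [div_div, div_eq_mul_inv]
    change _ ≤ D.value θ / m / ρ - 1
    rw [e2, lbTotal]
    linarith

/-! ### The iteration -/

lemma bound_le_LB_hyperUpdate (hR : D.HasReward) {h₀ h : Hyper M} (hp₀ : h₀.Pos) (hp : h.Pos) :
    (D.bound h₀ h : EReal) ≤ D.LB h₀.law (D.nodeUpdate h) (D.hyperUpdate h₀ h).law := by
  rw [← LB_nodeUpdate hR hp₀ hp]
  exact LB_le_LB_hyperUpdate hR hp₀ h hp.feasibleParams

lemma LB_hyperUpdate_le_bound (hR : D.HasReward) {h₀ : Hyper M} (hp₀ : h₀.Pos) (h : Hyper M) :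
    D.LB h₀.law (D.nodeUpdate h) (D.hyperUpdate h₀ h).law ≤
      (D.bound h₀ (D.hyperUpdate h₀ h) : EReal) :=
  LB_le_bound hR hp₀ (pos_hyperUpdate hp₀ h) (feasibleNodes_nodeUpdate hR h)

/-- A point which an iteration does not improve is a maximum. -/
lemma isVBMax_of_bound_le (hR : D.HasReward) {h₀ h : Hyper M} (hp₀ : h₀.Pos) (hp : h.Pos)
    (hle : D.bound h₀ (D.hyperUpdate h₀ h) ≤ D.bound h₀ h) :
    D.IsVBMax h₀.law (D.nodeUpdate h) h.law := by
  refine ⟨feasibleNodes_nodeUpdate hR h, hp.feasibleParams, fun q hq => ?_, fun Q hQ => ?_⟩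
  · rw [LB_nodeUpdate hR hp₀ hp]
    exact LB_le_bound hR hp₀ hp hq
  · rw [LB_nodeUpdate hR hp₀ hp]
    -- The best value over `Q` is attained at the updated law, and the next node update can only
    -- raise it; by assumption the result does not exceed the current value.
    exact ((LB_le_LB_hyperUpdate hR hp₀ h hQ).trans (LB_hyperUpdate_le_bound hR hp₀ h)).trans
      (EReal.coe_le_coe_iff.2 hle)

lemma hyperSeq_succ (h₀ hinit : Hyper M) (s : ℕ) :
    D.hyperSeq h₀ hinit (s + 1) = D.hyperUpdate h₀ (D.hyperSeq h₀ hinit s) :=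
  Function.iterate_succ_apply' _ _ _

lemma pos_hyperSeq {h₀ hinit : Hyper M} (hp₀ : h₀.Pos) (hpi : hinit.Pos) (s : ℕ) :
    (D.hyperSeq h₀ hinit s).Pos := by
  cases s with
  | zero => exact hpi
  | succ s => rw [hyperSeq_succ]; exact pos_hyperUpdate hp₀ _

lemma tendsToPoint_iff {u : ℕ → D.NodeWeights} {v : ℕ → Hyper M} {q : D.NodeWeights}
    {h : Hyper M} : TendsToPoint u v q h ↔
      (∀ k t z, Tendsto (fun s => u s k t z) atTop (𝓝 (q k t z))) ∧
        Tendsto (fun s => (v s).vec) atTop (𝓝 h.vec) := by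
  refine and_congr_right fun _ => ⟨?_, fun H => ?_⟩
  · rintro ⟨h1, h2, h3⟩
    refine tendsto_pi_nhds.2 ?_
    rintro ((x | x) | x)
    · exact h1 _ _ _ _ _
    · exact h2 _ _ _ _ _
    · exact h3 _ _ _
  · have H' := tendsto_pi_nhds.1 H
    exact ⟨fun n a o i j => H' (Sum.inl (Sum.inl ⟨n, a, o, i, j⟩)),
      fun n a o i j => H' (Sum.inl (Sum.inr ⟨n, a, o, i, j⟩)), fun n i a => H' (Sum.inr ⟨n, i, a⟩)⟩

lemma tendsto_bound (hR : D.HasReward) {h₀ h : Hyper M} (hp₀ : h₀.Pos) (hp : h.Pos)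
    {v : ℕ → Hyper M} (hv : ∀ s, (v s).Pos) (hl : Tendsto (fun s => (v s).vec) atTop (𝓝 h.vec)) :
    Tendsto (fun s => D.bound h₀ (v s)) atTop (𝓝 (D.bound h₀ h)) :=
  (((continuous_value.tendsto _).comp
    (Hyper.tendsto_tilde hp (Eventually.of_forall hv) hl)).log
      (hR.value_pos h.posParam_tilde).ne').sub
    (Hyper.tendsto_relEntropy hp₀ hp (Eventually.of_forall hv) hl)

lemma bound_le_log_marginalValue (hR : D.HasReward) {h₀ h : Hyper M} (hp₀ : h₀.Pos) (hp : h.Pos) :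
    D.bound h₀ h ≤ Real.log (D.marginalValue h₀.law) := by
  rw [← EReal.coe_le_coe_iff, ← LB_nodeUpdate hR hp₀ hp]
  exact LB_le_log_marginalValue hR hp₀ (feasibleNodes_nodeUpdate hR h) hp.feasibleParams

lemma exists_convergent_subseq (hR : D.HasReward) {h₀ hinit : Hyper M} (hp₀ : h₀.Pos)
    (hpi : hinit.Pos) {φ : ℕ → ℕ} (hφ : StrictMono φ) : ∃ ψ : ℕ → ℕ, StrictMono ψ ∧
      ∃ (q : D.NodeWeights) (h : Hyper M), TendsToPoint
        (fun s => D.nodeSeq h₀ hinit (φ (ψ s))) (fun s => D.hyperSeq h₀ hinit (φ (ψ s))) q h := by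
  obtain ⟨B, hB⟩ := exists_vec_hyperUpdate_le hR h₀
  -- The shift skips the initial hyper-parameters, which are arbitrary and may lie outside the box.
  have hmem : ∀ s, (D.hyperSeq h₀ hinit (φ (s + 1))).vec ∈ Set.Icc h₀.vec B := by
    intro s
    obtain ⟨r, hr⟩ : ∃ r, φ (s + 1) = r + 1 :=
      Nat.exists_eq_succ_of_ne_zero ((Nat.succ_pos s).trans_le (hφ.id_le (s + 1))).ne'
    rw [hr, hyperSeq_succ]
    exact ⟨vec_le_vec_hyperUpdate h₀ _, hB _⟩
  obtain ⟨c, hc, ψ, hψ, hlim⟩ := isCompact_Icc.tendsto_subseq hmem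
  have hp : (Hyper.ofVec c).Pos := Hyper.pos_iff_vec.2 fun x => by
    rw [Hyper.vec_ofVec]
    exact (Hyper.pos_iff_vec.1 hp₀ x).trans_le (hc.1 x)
  have hl : Tendsto (fun s => (D.hyperSeq h₀ hinit (φ (ψ s + 1))).vec) atTop
      (𝓝 (Hyper.ofVec c).vec) := by
    rw [Hyper.vec_ofVec]; exact hlim
  refine ⟨fun s => ψ s + 1, fun a b hab => Nat.add_lt_add_right (hψ hab) 1,
    D.nodeUpdate (Hyper.ofVec c), Hyper.ofVec c, tendsToPoint_iff.2 ⟨fun k t z => ?_, hl⟩⟩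
  exact tendsto_nodeUpdate hR (Hyper.tendsto_tilde hp
    (Eventually.of_forall fun s => pos_hyperSeq hp₀ hpi _) hl) k t z

/-- By continuity the limit and its update both have bound `L`, so an iteration started at the limit
gains nothing. -/
lemma isVBMax_of_tendsToPoint (hR : D.HasReward) {h₀ hinit : Hyper M} (hp₀ : h₀.Pos)
    (hpi : hinit.Pos) {L : ℝ}
    (hL : Tendsto (fun s => D.bound h₀ (D.hyperSeq h₀ hinit s)) atTop (𝓝 L))
    {φ : ℕ → ℕ} {q : D.NodeWeights} {h : Hyper M} (hφ : StrictMono φ)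
    (hlim : TendsToPoint (fun s => D.nodeSeq h₀ hinit (φ s))
      (fun s => D.hyperSeq h₀ hinit (φ s)) q h) :
    h.Pos ∧ D.IsVBMax h₀.law q h.law ∧ D.LB h₀.law q h.law = (L : EReal) := by
  obtain ⟨hq, hl⟩ := tendsToPoint_iff.1 hlim
  -- A limit of positive numbers might vanish; here all updated hyper-parameters stay above those of
  -- the prior.
  have hp : h.Pos := Hyper.pos_iff_vec.2 fun x => by
    refine (Hyper.pos_iff_vec.1 hp₀ x).trans_le (ge_of_tendsto (tendsto_pi_nhds.1 hl x) ?_)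
    filter_upwards [eventually_ge_atTop 1] with s hs
    obtain ⟨r, hr⟩ : ∃ r, φ s = r + 1 :=
      Nat.exists_eq_succ_of_ne_zero ((Nat.succ_le_iff.1 hs).trans_le (hφ.id_le s)).ne'
    rw [hr, hyperSeq_succ]
    exact vec_le_vec_hyperUpdate h₀ _ x
  have ht := Hyper.tendsto_tilde hp (Eventually.of_forall fun s => pos_hyperSeq hp₀ hpi (φ s)) hl
  have hqe : q = D.nodeUpdate h := by
    funext k t z
    exact tendsto_nhds_unique (hq k t z) (tendsto_nodeUpdate hR ht k t z)
  have hb : D.bound h₀ h = L := tendsto_nhds_unique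
    (tendsto_bound hR hp₀ hp (fun s => pos_hyperSeq hp₀ hpi (φ s)) hl) (hL.comp hφ.tendsto_atTop)
  have hb' : D.bound h₀ (D.hyperUpdate h₀ h) = L := by
    refine tendsto_nhds_unique (tendsto_bound hR hp₀ (pos_hyperUpdate hp₀ h)
      (fun s => pos_hyperUpdate hp₀ _) (tendsto_vec_hyperUpdate hR h₀ ht)) ?_
    -- The updates along the subsequence are the iterates of index `φ s + 1`, so their bounds also
    -- tend to `L`.
    have := hL.comp ((tendsto_add_atTop_nat 1).comp hφ.tendsto_atTop)
    simpa only [Function.comp_def, hyperSeq_succ] using this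
  subst hqe
  refine ⟨hp, isVBMax_of_bound_le hR hp₀ hp (hb'.trans hb.symm).le, ?_⟩
  rw [LB_nodeUpdate hR hp₀ hp, hb]

end Episodes

end DecSBPR

/-- Variational Bayes for Dec-SBPR: the updates increase the lower bound on the log marginal
empirical value monotonically, until convergence to a maximum. -/
theorem theorem1 (M : DecSBPR.Model) (D : DecSBPR.Episodes M)
    (hD : ∃ k, ∃ t ≤ D.T k, 0 < D.γ ^ t * (D.reward k t - D.Rmin))
    (h₀ hinit : DecSBPR.Hyper M) (hh₀ : h₀.Pos) (hhinit : hinit.Pos) :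
    -- the iterates are feasible, with a finite value of the lower bound
    (∀ s, DecSBPR.Episodes.FeasibleNodes (D.nodeSeq h₀ hinit s) ∧
      DecSBPR.Episodes.FeasibleParams (D.hyperSeq h₀ hinit s).law ∧
      ⊥ < D.LB h₀.law (D.nodeSeq h₀ hinit s) (D.hyperSeq h₀ hinit s).law) ∧
    -- the bound is a lower bound on the log marginal empirical value
    0 < D.marginalValue h₀.law ∧
    (∀ q Q, DecSBPR.Episodes.FeasibleNodes q → DecSBPR.Episodes.FeasibleParams Q →
      D.LB h₀.law q Q ≤ (Real.log (D.marginalValue h₀.law) : EReal)) ∧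
    -- neither of the two updates decreases the bound
    (∀ s, D.LB h₀.law (D.nodeSeq h₀ hinit s) (D.hyperSeq h₀ hinit s).law ≤
        D.LB h₀.law (D.nodeSeq h₀ hinit s) (D.hyperSeq h₀ hinit (s + 1)).law ∧
      D.LB h₀.law (D.nodeSeq h₀ hinit s) (D.hyperSeq h₀ hinit (s + 1)).law ≤
        D.LB h₀.law (D.nodeSeq h₀ hinit (s + 1)) (D.hyperSeq h₀ hinit (s + 1)).law) ∧
    -- an iteration increases the bound strictly, unless a maximum has been reached
    (∀ s, D.LB h₀.law (D.nodeSeq h₀ hinit s) (D.hyperSeq h₀ hinit s).law <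
        D.LB h₀.law (D.nodeSeq h₀ hinit (s + 1)) (D.hyperSeq h₀ hinit (s + 1)).law ∨
      D.IsVBMax h₀.law (D.nodeSeq h₀ hinit s) (D.hyperSeq h₀ hinit s).law) ∧
    -- every subsequence of the iterates has a convergent subsequence
    (∀ φ : ℕ → ℕ, StrictMono φ → ∃ ψ : ℕ → ℕ, StrictMono ψ ∧
      ∃ (q : D.NodeWeights) (h : DecSBPR.Hyper M), DecSBPR.Episodes.TendsToPoint
        (fun s => D.nodeSeq h₀ hinit (φ (ψ s))) (fun s => D.hyperSeq h₀ hinit (φ (ψ s))) q h) ∧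
    -- the bounds converge, and each limit point of the iterates is a maximum with the limit value
    ∃ L : ℝ,
      Tendsto (fun s => D.LB h₀.law (D.nodeSeq h₀ hinit s) (D.hyperSeq h₀ hinit s).law)
        atTop (𝓝 (L : EReal)) ∧
      ∀ (φ : ℕ → ℕ) (q : D.NodeWeights) (h : DecSBPR.Hyper M), StrictMono φ →
        DecSBPR.Episodes.TendsToPoint
          (fun s => D.nodeSeq h₀ hinit (φ s)) (fun s => D.hyperSeq h₀ hinit (φ s)) q h →
        h.Pos ∧ D.IsVBMax h₀.law q h.law ∧ D.LB h₀.law q h.law = (L : EReal) := by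
  have hR := D.hasReward_of_exists hD
  have hp := DecSBPR.Episodes.pos_hyperSeq (D := D) hh₀ hhinit
  have hLB : ∀ s, D.LB h₀.law (D.nodeSeq h₀ hinit s) (D.hyperSeq h₀ hinit s).law =
      (D.bound h₀ (D.hyperSeq h₀ hinit s) : EReal) := fun s =>
    DecSBPR.Episodes.LB_nodeUpdate hR hh₀ (hp s)
  have h1 : ∀ s, (D.bound h₀ (D.hyperSeq h₀ hinit s) : EReal) ≤
      D.LB h₀.law (D.nodeSeq h₀ hinit s) (D.hyperSeq h₀ hinit (s + 1)).law := fun s => by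
    rw [DecSBPR.Episodes.hyperSeq_succ]
    exact DecSBPR.Episodes.bound_le_LB_hyperUpdate hR hh₀ (hp s)
  have h2 : ∀ s, D.LB h₀.law (D.nodeSeq h₀ hinit s) (D.hyperSeq h₀ hinit (s + 1)).law ≤
      (D.bound h₀ (D.hyperSeq h₀ hinit (s + 1)) : EReal) := fun s => by
    rw [DecSBPR.Episodes.hyperSeq_succ]
    exact DecSBPR.Episodes.LB_hyperUpdate_le_bound hR hh₀ _
  have hmono : Monotone fun s => D.bound h₀ (D.hyperSeq h₀ hinit s) :=
    monotone_nat_of_le_succ fun s => EReal.coe_le_coe_iff.1 ((h1 s).trans (h2 s))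
  have hbdd : BddAbove (Set.range fun s => D.bound h₀ (D.hyperSeq h₀ hinit s)) :=
    ⟨_, Set.forall_mem_range.2 fun s =>
      DecSBPR.Episodes.bound_le_log_marginalValue hR hh₀ (hp s)⟩
  have hL := tendsto_atTop_ciSup hmono hbdd
  simp only [hLB]
  refine ⟨fun s => ⟨DecSBPR.Episodes.feasibleNodes_nodeUpdate hR _, (hp s).feasibleParams,
      EReal.bot_lt_coe _⟩, DecSBPR.Episodes.marginalValue_pos hR hh₀,
    fun q Q hq hQ => DecSBPR.Episodes.LB_le_log_marginalValue hR hh₀ hq hQ,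
    fun s => ⟨h1 s, h2 s⟩, fun s => ?_,
    fun φ hφ => DecSBPR.Episodes.exists_convergent_subseq hR hh₀ hhinit hφ, _,
    (continuous_coe_real_ereal.tendsto _).comp hL,
    fun φ q h hφ hlim => DecSBPR.Episodes.isVBMax_of_tendsToPoint hR hh₀ hhinit hL hφ hlim⟩
  -- If the increase is not strict, the iteration does not improve the current point.
  rw [EReal.coe_lt_coe_iff, or_iff_not_imp_left, not_lt, DecSBPR.Episodes.hyperSeq_succ]
  exact DecSBPR.Episodes.isVBMax_of_bound_le hR hh₀ (hp s)
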